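/- **Conventions.** Let $\mathcal A$ be an abelian category. A *subcategory* of $\mathcal A$ is a full additive subcategory closed under isomorphisms. Let $\mathcal W$ be a subcategory of $\mathcal A$. Write $\mathcal W\perp\mathcal W$ if $\operatorname{Ext}^{n}_{\mathcal A}(X,Y)=0$ for all $X,Y\in\mathcal W$ and $n\ge 1$. A subcategory has the *two-of-three property* if it is closed under extensions, kernels of epimorphisms and cokernels of monomorphisms. A *$\mathcal W$-resolution* of $M$ is a complex $W=(\cdots\to W_1\to W_0\to 0)$ of objects of $\mathcal W$ with a morphism $W\to M$ such that the augmented complex $\cdots\to W_1\to W_0\to M\to 0$ is exact; it is *proper* if $\operatorname{Hom}_{\mathcal A}(U,-)$ keeps the augmented complex exact for every $U\in\mathcal W$. Set $\mathcal W\text{-pd}(M)=\inf_W\sup\{n\ge 0\mid W_n\ne 0\}$, the infimum being over all $\mathcal W$-resolutions $W$ of $M$ (and $\infty$ if there is none). *(Proper) $\mathcal W$-coresolutions* and $\mathcal W\text{-id}$ are defined dually (properness through $\operatorname{Hom}_{\mathcal A}(-,U)$). Complexes are graded homologically, so coresolutions live in degrees $\le 0$. A complex $T=(T_n)_{n\in\mathbb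 Z}$ of objects of $\mathcal W$ is *totally $\mathcal W$-acyclic* if $T$, $\operatorname{Hom}_{\mathcal A}(U,T)$ and $\operatorname{Hom}_{\mathcal A}(T,U)$ are exact for all $U\in\mathcal W$. Let $\mathcal G(\mathcal W)$ be the subcategory of the objects isomorphic to $\operatorname{Coker}(\partial_1^T)$ for some totally $\mathcal W$-acyclic $T$. A *Tate $\mathcal W$-resolution* of $M$ is a diagram of morphisms of complexes $T\xrightarrow{\alpha}W\xrightarrow{\gamma}M$ where $T$ is totally $\mathcal W$-acyclic, $\gamma$ is a proper $\mathcal W$-resolution, and $\alpha_n$ is an isomorphism for $n\gg 0$. A *Tate $\mathcal W$-coresolution* of $N$ is a diagram of morphisms of complexes $N\xrightarrow{\delta}V\xrightarrow{\beta}S$ where $S$ is totally $\mathcal W$-acyclic, $\delta$ is a proper $\mathcal W$-coresolution, and $\beta_n$ is an isomorphism for $n\ll 0$. Let $R$ be a commutative ring. An $R$-module $C$ is *semidualizing* if it has a (possibly unbounded) resolution by free modules of finite rank, the homothety map $R\to\operatorname{Hom}_R(C,C)$ is an isomorphism, and $\operatorname{Ext}_R^{n}(C,C)=0$ for $n\ge1$.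 Let $\mathcal P_C$ be the subcategory of the $R$-modules isomorphic to $P\otimes_R C$ with $P$ projective, and $\mathcal I_C$ that of the $R$-modules isomorphic to $\operatorname{Hom}_R(C,I)$ with $I$ injective. **Theorem.** 1. Let $R$ be a commutative ring and $C$ a semidualizing $R$-module. An $R$-module $M$ admits a Tate $\mathcal P_C$-resolution if and only if $\mathcal G(\mathcal P_C)\text{-pd}(M)<\infty$. An $R$-module $N$ admits a Tate $\mathcal I_C$-coresolution if and only if $\mathcal G(\mathcal I_C)\text{-id}(N)<\infty$. The class of modules of finite $\mathcal G(\mathcal P_C)$-projective dimension and the class of modules of finite $\mathcal G(\mathcal I_C)$-injective dimension are closed under direct summands and satisfy the two-of-three property. 2. Let $\mathcal W$ be a subcategory of an abelian category $\mathcal A$ that is closed under kernels of epimorphisms and satisfies $\mathcal W\perp\mathcal W$. For every object $M$ of $\mathcal A$, the following are equivalent: $M$ admits a Tate $\mathcal W$-resolution; $M$ admits a Tate $\mathcal W$-resolution in which every $\alpha_n$ is a split surjection; $\mathcal G(\mathcal W)\text{-pd}(M)<\infty$. The class of these objects is closed under direct summands and satisfies the two-of-three property. 3. Let $\mathcal V$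 be a subcategory of an abelian category $\mathcal A$ that is closed under cokernels of monomorphisms and satisfies $\mathcal V\perp\mathcal V$. For every object $N$ of $\mathcal A$, the following are equivalent: $N$ admits a Tate $\mathcal V$-coresolution; $N$ admits a Tate $\mathcal V$-coresolution in which every $\beta_n$ is a split injection; $\mathcal G(\mathcal V)\text{-id}(N)<\infty$. The class of these objects is closed under direct summands and satisfies the two-of-three property. -/

import Mathlib

open CategoryTheory CategoryTheory.Limits

universe u v w x

namespace Tate

section Abstract

variable {A : Type v} [Category.{w} A] [Abelian A]

/-- "Subcategory" means a full additive subcategory closed under isomorphisms; it is encoded by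
the property of belonging to it. -/
structure IsSubcategory (P : ObjectProperty A) : Prop where
  zero : ∀ X : A, IsZero X → P X
  iso : ∀ {X Y : A}, (X ≅ Y) → P X → P Y
  biprod : ∀ X Y : A, P X → P Y → P (X ⊞ Y)

/-- Closed under kernels of epimorphisms. -/
def ClosedUnderKernelsOfEpis (P : ObjectProperty A) : Prop :=
  ∀ S : ShortComplex A, S.ShortExact → P S.X₂ → P S.X₃ → P S.X₁

/-- Closed under cokernels of monomorphisms. -/
def ClosedUnderCokernelsOfMonos (P : ObjectProperty A) : Prop :=
  ∀ S : ShortComplex A, S.ShortExact → P S.X₁ → P S.X₂ → P S.X₃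

/-- Closed under extensions. -/
def ClosedUnderExtensions (P : ObjectProperty A) : Prop :=
  ∀ S : ShortComplex A, S.ShortExact → P S.X₁ → P S.X₃ → P S.X₂

/-- The two-of-three property. -/
structure TwoOfThree (P : ObjectProperty A) : Prop where
  extensions : ClosedUnderExtensions P
  kernels : ClosedUnderKernelsOfEpis P
  cokernels : ClosedUnderCokernelsOfMonos P

/-- Closed under direct summands. -/
def ClosedUnderSummands (P : ObjectProperty A) : Prop :=
  ∀ M N : A, P (M ⊞ N) → P M

/-- `P ⊥ Q`: all `Ext^n(X, Y)` with `X ∈ P`, `Y ∈ Q`, `n ≥ 1` vanish. -/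
def Perp [HasExt.{x} A] (P Q : ObjectProperty A) : Prop :=
  ∀ X Y : A, P X → Q Y → ∀ n : ℕ, 1 ≤ n → Subsingleton (Abelian.Ext.{x} X Y n)

/-- `K` is `Hom(P, -)`-exact: the complex of abelian groups `Hom(U, K)` is exact for all
`U ∈ P`. -/
def HomFromExact {ι : Type*} {c : ComplexShape ι} (P : ObjectProperty A)
    (K : HomologicalComplex A c) : Prop :=
  ∀ U : A, P U →
    (((preadditiveCoyoneda.obj (Opposite.op U)).mapHomologicalComplex c).obj K).Acyclic

/-- `K` is `Hom(-, P)`-exact: the complex of abelian groups `Hom(K, U)` is exact for all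
`U ∈ P`. -/
def HomToExact {ι : Type*} {c : ComplexShape ι} (P : ObjectProperty A)
    (K : HomologicalComplex A c) : Prop :=
  ∀ U : A, P U →
    (((preadditiveYoneda.obj U).mapHomologicalComplex c.symm).obj K.op).Acyclic

/-- A `P`-resolution of `M`: a complex `⋯ ⟶ X₁ ⟶ X₀` of objects of `P` with an augmentation
`X₀ ⟶ M` such that the augmented complex `⋯ ⟶ X₁ ⟶ X₀ ⟶ M ⟶ 0` is exact. -/
structure Resolution (P : ObjectProperty A) (M : A) where
  cx : ChainComplex A ℕ
  ε : cx.X 0 ⟶ M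
  w : cx.d 1 0 ≫ ε = 0
  mem : ∀ n, P (cx.X n)
  exact : (cx.augment ε w).Acyclic

/-- The resolution is proper: its augmented complex is `Hom(P, -)`-exact. -/
def Resolution.IsProper {P : ObjectProperty A} {M : A} (X : Resolution P M) : Prop :=
  HomFromExact P (X.cx.augment X.ε X.w)

/-- A `P`-coresolution of `N`: a complex `Y⁰ ⟶ Y¹ ⟶ ⋯` of objects of `P` (where `Yⁿ` stands for
the object in homological degree `-n`) with a coaugmentation `N ⟶ Y⁰` such that the complex
`0 ⟶ N ⟶ Y⁰ ⟶ Y¹ ⟶ ⋯` is exact. -/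
structure Coresolution (P : ObjectProperty A) (N : A) where
  cx : CochainComplex A ℕ
  η : N ⟶ cx.X 0
  w : η ≫ cx.d 0 1 = 0
  mem : ∀ n, P (cx.X n)
  exact : (cx.augment η w).Acyclic

/-- The coresolution is proper: its augmented complex is `Hom(-, P)`-exact. -/
def Coresolution.IsProper {P : ObjectProperty A} {N : A} (Y : Coresolution P N) : Prop :=
  HomToExact P (Y.cx.augment Y.η Y.w)

/-- The `P`-projective dimension `inf {sup {n ≥ 0 | Xₙ ≠ 0} | X a P-resolution of M}`. -/
noncomputable def projDim (P : ObjectProperty A) (M : A) : ℕ∞ :=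
  ⨅ X : Resolution P M, ⨆ (n : ℕ) (_ : ¬ IsZero (X.cx.X n)), (n : ℕ∞)

/-- The `P`-injective dimension, defined dually. -/
noncomputable def injDim (P : ObjectProperty A) (N : A) : ℕ∞ :=
  ⨅ Y : Coresolution P N, ⨆ (n : ℕ) (_ : ¬ IsZero (Y.cx.X n)), (n : ℕ∞)

/-- The objects of finite `P`-projective dimension. -/
def FiniteProjDim (P : ObjectProperty A) : ObjectProperty A := fun M => projDim P M < ⊤

/-- The objects of finite `P`-injective dimension. -/
def FiniteInjDim (P : ObjectProperty A) : ObjectProperty A := fun N => injDim P N < ⊤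

/-- Totally `P`-acyclic complexes. -/
structure TotallyAcyclic (P : ObjectProperty A) (T : ChainComplex A ℤ) : Prop where
  mem : ∀ n, P (T.X n)
  exact : T.Acyclic
  homFrom : HomFromExact P T
  homTo : HomToExact P T

/-- `G(P)`: the objects isomorphic to `Coker (∂₁ : T₁ ⟶ T₀)` for a totally `P`-acyclic `T`. -/
def Gor (P : ObjectProperty A) : ObjectProperty A := fun M =>
  ∃ T : ChainComplex A ℤ, TotallyAcyclic P T ∧ Nonempty (M ≅ cokernel (T.d 1 0))

/-- A Tate `P`-resolution `T ⟶ W ⟶ M`. As `Wₙ = 0` for `n < 0`, a morphism of complexes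
`α : T ⟶ W` is given by its components of degree `n ≥ 0`. -/
structure TateResolution (P : ObjectProperty A) (M : A) where
  T : ChainComplex A ℤ
  totallyAcyclic : TotallyAcyclic P T
  W : Resolution P M
  proper : W.IsProper
  α : ∀ n : ℕ, T.X (n : ℤ) ⟶ W.cx.X n
  comm : ∀ i j : ℕ, α i ≫ W.cx.d i j = T.d (i : ℤ) (j : ℤ) ≫ α j
  eventually_iso : ∃ n₀ : ℕ, ∀ n : ℕ, n₀ ≤ n → IsIso (α n)

/-- A Tate `P`-coresolution `N ⟶ V ⟶ S`. As `Vₙ = 0` for `n > 0`, a morphism of complexes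
`β : V ⟶ S` is given by its components of degree `-n ≤ 0`. -/
structure TateCoresolution (P : ObjectProperty A) (N : A) where
  S : ChainComplex A ℤ
  totallyAcyclic : TotallyAcyclic P S
  V : Coresolution P N
  proper : V.IsProper
  β : ∀ n : ℕ, V.cx.X n ⟶ S.X (-(n : ℤ))
  comm : ∀ i j : ℕ, β i ≫ S.d (-(i : ℤ)) (-(j : ℤ)) = V.cx.d i j ≫ β j
  eventually_iso : ∃ n₀ : ℕ, ∀ n : ℕ, n₀ ≤ n → IsIso (β n)

/-- The objects admitting a Tate `P`-resolution. -/
def AdmitsTateResolution (P : ObjectProperty A) : ObjectProperty A := fun M =>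
  Nonempty (TateResolution P M)

/-- The objects admitting a Tate `P`-coresolution. -/
def AdmitsTateCoresolution (P : ObjectProperty A) : ObjectProperty A := fun N =>
  Nonempty (TateCoresolution P N)

end Abstract

section Modules

variable {R : Type u} [CommRing R]

/-- The finitely generated free modules. -/
def finiteFree (R : Type u) [CommRing R] : ObjectProperty (ModuleCat.{u} R) := fun F =>
  Module.Free R F ∧ Module.Finite R F

/-- Semidualizing modules. -/
structure IsSemidualizing (C : ModuleCat.{u} R) : Prop where
  resolution : Nonempty (Resolution (finiteFree R) C)
  homothety : Function.Bijective (LinearMap.lsmul R C)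
  ext : ∀ n : ℕ, 1 ≤ n → Subsingleton (Abelian.Ext.{u} C C n)

/-- The `C`-projective modules `P ⊗ C`, `P` projective. -/
def cProjective (C : ModuleCat.{u} R) : ObjectProperty (ModuleCat.{u} R) := fun M =>
  ∃ P : ModuleCat.{u} R, Module.Projective R P ∧ Nonempty (M ≃ₗ[R] TensorProduct R P C)

/-- The `C`-injective modules `Hom(C, I)`, `I` injective. -/
def cInjective (C : ModuleCat.{u} R) : ObjectProperty (ModuleCat.{u} R) := fun N =>
  ∃ I : ModuleCat.{u} R, Module.Injective R I ∧ Nonempty (N ≃ₗ[R] (C →ₗ[R] I))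

end Modules

end Tate

/-!
Fix a class `W` of objects with `Ext^n(X, Y) = 0` for `X`, `Y` in `W` and `n ≥ 1`.

The syzygies of a totally `W`-acyclic complex form a doubly infinite sequence of short exact
sequences with middle terms in `W` that stay exact under `Hom(U, -)` and `Hom(-, U)`. The class
`IsGor W` of objects occurring in such sequences equals `Gor W` (`gor_eq_isGor`), and it is the
largest class that unfolds in both directions, so that membership can be proved by coinduction
(`IsGor.coind`), one step at a time. It is closed under extensions by the horseshoe lemma
(`IsGor.extension`). It is closed under direct summands (`IsGor.summand`): if `L` is the kernel of
an epimorphism `T ⟶ X ⊞ Y`, then the kernels `K₁` and `K₂` of its two components fit into a short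
exact sequence `0 ⟶ L ⟶ K₁ ⊞ K₂ ⟶ T ⟶ 0` (`IsSES.exists_kernels_biprod`), so `K₁` is again a direct
summand of an object of `IsGor W`.

Next consider the objects one of whose syzygies is in `IsGor W` (`EventuallyGor`). `Ext^n(U, -)`
vanishes on them for `U` in `W` and `n ≥ 1`, so the horseshoe lemma applies as before and gives
closure under extensions and direct summands, and closure under cokernels of monomorphisms follows
from extensions. If `W` is closed under kernels of epimorphisms, then every epimorphism from such an
object to an object of `W` is split (`EventuallyGor.exists_section`), and closure under kernels of
epimorphisms follows by pulling back along a cover.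

These are the objects of finite `Gor W`-dimension and also the objects with a Tate resolution
(`tateResolution_tfae`). A Tate resolution identifies a high syzygy with a syzygy of a totally
acyclic complex, and cutting a resolution at a syzygy in `IsGor W` bounds its length. Objects of
finite `Gor W`-dimension are reached by repeatedly taking cokernels. A Tate resolution with split
epimorphisms `αₙ` is built downwards from a syzygy `M'` in `IsGor W`
(`SyzygyGor.exists_approx`): a map `Y' ⟶ M'` with `Y'` in `IsGor W` is pushed one step down a given
`0 ⟶ M' ⟶ U ⟶ M ⟶ 0` by embedding `Y'` into some `H` in `W` and using the split epimorphism
`H ⊞ U ⟶ U`.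

Everything uses `Ext` only through the formal properties collected in `ExtVan`, which are
self-dual. The statements on coresolutions are therefore the same statements in the opposite
category (`tateCoresolution_tfae`).

It remains to see that `cProjective C` and `cInjective C` satisfy the hypotheses for a semidualizing
module `C`. They consist of the modules reconstructed by the adjunction between `- ⊗ C` and
`Hom(C, -)` from a projective, respectively injective, module (`IsCProj`, `IsCInj`), so they are
closed under retracts. As `C` is finitely generated and faithful, `Hom(C, D) = 0` forces `D = 0`
over any commutative ring (`subsingleton_of_hom_eq_zero`, by a determinant argument), and
`D ⊗ C = 0` likewise. Hence surjections within `cProjective C` and injections within `cInjective C`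
are split, and the closure properties follow. Orthogonality is reduced to `Ext^n(C, C) = 0` by
dimension shifting along the syzygies `Z` of `C`, which are finitely presented: `Hom(Z, -)` commutes
with direct sums (`van_syzygy_finsupp`), and `Hom(C, I) ⊗ Z ≅ Hom(Hom(Z, C), I)` for injective `I`
(`tensorEval_bijective`).
-/

namespace Tate

/-! ### Short exact sequences -/

section ShortExact

variable {A : Type v} [Category.{w} A] [Abelian A]

/-- `0 ⟶ X ⟶ Y ⟶ Z ⟶ 0` is a short exact sequence; unlike `ShortComplex.ShortExact` this is a
predicate on a pair of composable morphisms. -/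
def IsSES {X Y Z : A} (f : X ⟶ Y) (g : Y ⟶ Z) : Prop :=
  ∃ w : f ≫ g = 0, (ShortComplex.mk f g w).ShortExact

namespace IsSES

variable {X Y Z : A} {f : X ⟶ Y} {g : Y ⟶ Z}

lemma zero (h : IsSES f g) : f ≫ g = 0 := h.1

lemma mono (h : IsSES f g) : Mono f := h.2.mono_f

lemma epi (h : IsSES f g) : Epi g := h.2.epi_g

lemma exists_lift (h : IsSES f g) {T : A} (k : T ⟶ Y) (hk : k ≫ g = 0) : ∃ l, l ≫ f = k := by
  have := h.2.mono_f
  exact ⟨h.2.exact.lift k hk, h.2.exact.lift_f k hk⟩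

lemma exists_desc (h : IsSES f g) {T : A} (k : Y ⟶ T) (hk : f ≫ k = 0) : ∃ l, g ≫ l = k := by
  have := h.2.epi_g
  exact ⟨h.2.exact.desc k hk, h.2.exact.g_desc k hk⟩

lemma of_lift (w : f ≫ g = 0) (hf : Mono f) (hg : Epi g)
    (H : ∀ (T : A) (k : T ⟶ Y), k ≫ g = 0 → ∃ l, l ≫ f = k) : IsSES f g := by
  refine ⟨w, .mk' ?_ hf hg⟩
  rw [ShortComplex.exact_iff_exact_up_to_refinements]
  intro T k hk
  obtain ⟨l, hl⟩ := H T k hk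
  exact ⟨T, 𝟙 T, inferInstance, l, by simpa using hl.symm⟩

lemma of_epi (g : Y ⟶ Z) [Epi g] : IsSES (kernel.ι g) g :=
  of_lift (kernel.condition g) inferInstance inferInstance
    fun _ k hk => ⟨kernel.lift g k hk, kernel.lift_ι _ _ _⟩

lemma op (h : IsSES f g) : IsSES g.op f.op := ⟨by rw [← op_comp, h.zero, op_zero], h.2.op⟩

lemma unop {X Y Z : Aᵒᵖ} {f : X ⟶ Y} {g : Y ⟶ Z} (h : IsSES f g) : IsSES g.unop f.unop :=
  ⟨by rw [← unop_comp, h.zero, unop_zero], h.2.unop⟩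

lemma of_mono (f : X ⟶ Y) [Mono f] : IsSES f (cokernel.π f) := by
  refine ⟨cokernel.condition f, .mk' ?_ inferInstance inferInstance⟩
  exact ShortComplex.exact_of_g_is_cokernel _ (cokernelIsCokernel f)

lemma comp_iso (h : IsSES f g) {Z' : A} (e : Z ≅ Z') : IsSES f (g ≫ e.hom) := by
  have := h.epi
  refine of_lift (by simp [reassoc_of% h.zero]) h.mono inferInstance fun T k hk =>
    h.exists_lift k ?_
  rw [← cancel_mono e.hom, Category.assoc, hk, zero_comp]

lemma biprod (X Y : A) : IsSES (biprod.inl : X ⟶ X ⊞ Y) biprod.snd :=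
  of_lift (by simp) inferInstance inferInstance fun T k hk =>
    ⟨k ≫ biprod.fst, by ext <;> simp [hk]⟩

lemma biprod' (X Y : A) : IsSES (biprod.inr : Y ⟶ X ⊞ Y) biprod.fst :=
  of_lift (by simp) inferInstance inferInstance fun T k hk =>
    ⟨k ≫ biprod.snd, by ext <;> simp [hk]⟩

lemma id_zero {O : A} (hO : IsZero O) (X : A) : IsSES (𝟙 X) (0 : X ⟶ O) :=
  of_lift (by simp) inferInstance ⟨fun _ _ _ => hO.eq_of_src _ _⟩ fun T k _ => ⟨k, by simp⟩

lemma zero_id {O : A} (hO : IsZero O) (X : A) : IsSES (0 : O ⟶ X) (𝟙 X) :=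
  of_lift (by simp) ⟨fun _ _ _ => hO.eq_of_tgt _ _⟩ inferInstance fun T k hk =>
    ⟨0, by simpa using hk.symm⟩

lemma conj_iso (h : IsSES f g) {Y' : A} (e : Y ≅ Y') : IsSES (f ≫ e.hom) (e.inv ≫ g) := by
  have := h.mono
  have := h.epi
  refine of_lift (by simp [h.zero]) inferInstance inferInstance fun T k hk => ?_
  obtain ⟨l, hl⟩ := h.exists_lift (k ≫ e.inv) (by simpa using hk)
  exact ⟨l, by rw [← Category.assoc, hl]; simp⟩

/-- The direct sum of a short exact sequence with `0 ⟶ U ⟶ U`. -/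
lemma biprod_id (h : IsSES f g) (U : A) :
    IsSES (f ≫ (biprod.inl : Y ⟶ Y ⊞ U)) (biprod.map g (𝟙 U)) := by
  have := h.mono
  have := h.epi
  refine of_lift (by simp [reassoc_of% h.zero]) (mono_comp _ _) inferInstance fun T k hk => ?_
  have e1 := hk =≫ biprod.fst
  have e2 := hk =≫ biprod.snd
  simp only [Category.assoc, biprod.map_fst, biprod.map_snd, zero_comp, Category.comp_id] at e1 e2
  obtain ⟨l, hl⟩ := h.exists_lift (k ≫ biprod.fst) (by simpa using e1)
  exact ⟨l, by ext <;> simp [reassoc_of% hl, e2]⟩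

/-- The pullback of a short exact sequence along a morphism to its cokernel. -/
lemma of_isPullback (h : IsSES f g) {P Z' : A} {h' : P ⟶ Y} {g' : P ⟶ Z'} {b : Z' ⟶ Z}
    (hp : IsPullback h' g' g b) : ∃ f' : X ⟶ P, IsSES f' g' ∧ f' ≫ h' = f := by
  have := h.epi
  have := h.mono
  have hw : f ≫ g = 0 ≫ b := by simp [h.zero]
  have e1 : hp.lift f 0 hw ≫ h' = f := hp.lift_fst ..
  have e2 : hp.lift f 0 hw ≫ g' = 0 := hp.lift_snd ..
  refine ⟨hp.lift f 0 hw, of_lift e2 ?_ ?_ ?_, e1⟩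
  · have : Mono (hp.lift f 0 hw ≫ h') := by rw [e1]; infer_instance
    exact mono_of_mono _ h'
  · exact Abelian.epi_snd_of_isLimit _ _ hp.isLimit
  · intro T k hk
    obtain ⟨l, hl⟩ := h.exists_lift (k ≫ h') (by rw [Category.assoc, hp.w, reassoc_of% hk]; simp)
    exact ⟨l, hp.hom_ext (by rw [Category.assoc, e1, hl]) (by rw [Category.assoc, e2, hk]; simp)⟩

/-- The kernel of a composite of two epimorphisms is an extension of the two kernels. -/
lemma exists_kernel_comp {T B K₁ : A} {a : K₁ ⟶ T} {p : T ⟶ Y} {b : B ⟶ Y} {q : Y ⟶ Z}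
    (h₁ : IsSES a p) (h₂ : IsSES b q) :
    ∃ (K : A) (k : K ⟶ T) (a' : K₁ ⟶ K) (p' : K ⟶ B), IsSES k (p ≫ q) ∧ IsSES a' p' := by
  have := h₁.epi
  have := h₂.epi
  have := h₂.mono
  have hp := IsPullback.of_hasPullback p b
  obtain ⟨a', ha, -⟩ := h₁.of_isPullback hp
  refine ⟨_, pullback.fst p b, a', pullback.snd p b, of_lift ?_ inferInstance inferInstance ?_, ha⟩
  · rw [← Category.assoc, hp.w, Category.assoc, h₂.zero, comp_zero]
  · intro S k hk
    obtain ⟨l, hl⟩ := h₂.exists_lift (k ≫ p) (by simpa using hk)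
    exact ⟨hp.lift k l hl.symm, hp.lift_fst _ _ _⟩

/-- The horseshoe lemma for one step of a resolution; instead of projectivity of `TZ` only a lift of
`TZ ⟶ Z` to `Y` is required. The middle row is the pullback of `TX ⊞ TZ ⟶ Y ⟵ X` combined with
`TX ⟶ X`. -/
lemma horseshoe {TX TZ X' Z' : A} {a' : X' ⟶ TX} {a : TX ⟶ X} {b' : Z' ⟶ TZ} {b : TZ ⟶ Z}
    (h : IsSES f g) (hX : IsSES a' a) (hZ : IsSES b' b) (hl : ∃ l, l ≫ g = b) :
    ∃ (Y' : A) (f' : X' ⟶ Y') (g' : Y' ⟶ Z') (k : Y' ⟶ TX ⊞ TZ) (p : TX ⊞ TZ ⟶ Y),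
      IsSES f' g' ∧ IsSES k p := by
  obtain ⟨l, rfl⟩ := hl
  have := hX.epi
  have := hX.mono
  have := h.mono
  have hp : IsPullback biprod.snd (biprod.desc f l) (l ≫ g) g := by
    refine ⟨⟨by ext <;> simp [h.zero]⟩, ⟨PullbackCone.IsLimit.mk _
      (fun s => biprod.lift (h.exists_lift (s.snd - s.fst ≫ l)
        (by simp [s.condition])).choose s.fst) (fun s => by simp) (fun s => ?_)
        (fun s m h₁ h₂ => ?_)⟩⟩
    · have := (h.exists_lift (s.snd - s.fst ≫ l) (by simp [s.condition])).choose_spec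
      simp [biprod.lift_desc, this]
    · have := (h.exists_lift (s.snd - s.fst ≫ l) (by simp [s.condition])).choose_spec
      apply biprod.hom_ext
      · rw [← cancel_mono f, biprod.lift_fst, this, ← h₁, ← h₂]
        have : m ≫ biprod.desc f l = m ≫ (biprod.fst ≫ f + biprod.snd ≫ l) := by
          congr 1; ext <;> simp
        rw [this]
        simp
      · simpa using h₁
  obtain ⟨s, hs, -⟩ := hZ.of_isPullback hp
  obtain ⟨K, k, f', g', hk, hfg⟩ := (hX.biprod_id TZ).exists_kernel_comp hs
  exact ⟨K, f', g', k, _, hfg, hk⟩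

/-- If `L` is the kernel of an epimorphism `p : T ⟶ X ⊞ Y`, then the kernels of the two components
of `p` intersect in `L` and generate `T`. -/
lemma exists_kernels_biprod {L T : A} {i : L ⟶ T} {p : T ⟶ X ⊞ Y} (h : IsSES i p) :
    ∃ (K₁ K₂ : A) (k₁ : K₁ ⟶ T) (k₂ : K₂ ⟶ T) (j : L ⟶ K₁ ⊞ K₂),
      IsSES k₁ (p ≫ biprod.fst) ∧ IsSES k₂ (p ≫ biprod.snd) ∧ IsSES j (biprod.desc k₁ k₂) := by
  have := h.epi
  have := h.mono
  have h₁ := of_epi (p ≫ biprod.fst)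
  have h₂ := of_epi (p ≫ biprod.snd)
  obtain ⟨l₁, hl₁⟩ := h₁.exists_lift i (by simp [reassoc_of% h.zero])
  obtain ⟨l₂, hl₂⟩ := h₂.exists_lift i (by simp [reassoc_of% h.zero])
  refine ⟨_, _, _, _, biprod.lift l₁ (-l₂), h₁, h₂, of_lift ?_ ?_ ?_ ?_⟩
  · simp [biprod.lift_desc, hl₁, hl₂]
  · refine ⟨fun u v huv => ?_⟩
    have := (huv =≫ biprod.fst) =≫ kernel.ι _
    simp only [Category.assoc, biprod.lift_fst, hl₁] at this
    rwa [cancel_mono] at this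
  · rw [epi_iff_surjective_up_to_refinements]
    intro S y
    obtain ⟨S', π, hπ, c, hc⟩ :=
      surjective_up_to_refinements_of_epi p (y ≫ p ≫ biprod.fst ≫ biprod.inl)
    obtain ⟨c₂, hc₂⟩ := h₂.exists_lift c (by rw [← Category.assoc, ← hc]; simp)
    obtain ⟨c₁, hc₁⟩ := h₁.exists_lift (π ≫ y - c)
      (by rw [Preadditive.sub_comp, ← Category.assoc c, ← hc]; simp)
    exact ⟨S', π, hπ, biprod.lift c₁ c₂, by rw [biprod.lift_desc, hc₁, hc₂]; simp⟩
  · intro S k hk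
    have hk' : (k ≫ biprod.fst) ≫ kernel.ι (p ≫ biprod.fst) +
        (k ≫ biprod.snd) ≫ kernel.ι (p ≫ biprod.snd) = 0 := by
      rw [← hk, ← biprod.lift_desc]
      congr 1
      ext <;> simp
    have hk₂ : (k ≫ biprod.fst) ≫ kernel.ι (p ≫ biprod.fst) =
        -((k ≫ biprod.snd) ≫ kernel.ι (p ≫ biprod.snd)) := eq_neg_of_add_eq_zero_left hk'
    obtain ⟨l, hl⟩ := h.exists_lift ((k ≫ biprod.fst) ≫ kernel.ι (p ≫ biprod.fst)) (by
      apply biprod.hom_ext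
      · rw [Category.assoc, Category.assoc, h₁.zero]; simp
      · rw [hk₂, Category.assoc, Preadditive.neg_comp, Category.assoc, h₂.zero]; simp)
    refine ⟨l, ?_⟩
    apply biprod.hom_ext
    · rw [← cancel_mono (kernel.ι (p ≫ biprod.fst)), Category.assoc, Category.assoc,
        biprod.lift_fst_assoc, hl₁, hl, Category.assoc]
    · rw [← cancel_mono (kernel.ι (p ≫ biprod.snd)), Category.assoc, Category.assoc,
        biprod.lift_snd_assoc, Preadditive.neg_comp, hl₂, Preadditive.comp_neg, hl, hk₂, neg_neg]

/-- A short exact sequence with a section is a biproduct. -/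
lemma nonempty_iso_biprod (h : IsSES f g) {s : Z ⟶ Y} (hs : s ≫ g = 𝟙 Z) :
    Nonempty (Y ≅ X ⊞ Z) := by
  have := h.mono
  have := h.epi
  obtain ⟨r, hr⟩ := h.exists_lift (𝟙 Y - g ≫ s) (by simp [hs])
  refine ⟨⟨biprod.lift r g, biprod.desc f s, by simp [biprod.lift_desc, hr], ?_⟩⟩
  have e1 : f ≫ r = 𝟙 X := by
    rw [← cancel_mono f, Category.assoc, hr]; simp [reassoc_of% h.zero]
  have e2 : s ≫ r = 0 := by
    rw [← cancel_mono f, Category.assoc, hr]; simp [reassoc_of% hs]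
  apply biprod.hom_ext' <;> apply biprod.hom_ext <;> simp [e1, e2, hs, h.zero]

end IsSES

lemma nonempty_op_biprod_iso (X Y : A) :
    Nonempty (Opposite.op (X ⊞ Y) ≅ Opposite.op X ⊞ Opposite.op Y) :=
  (IsSES.biprod' X Y).op.nonempty_iso_biprod (s := biprod.snd.op) (by rw [← op_comp]; simp)

lemma nonempty_unop_biprod_iso (X Y : Aᵒᵖ) : Nonempty ((X ⊞ Y).unop ≅ X.unop ⊞ Y.unop) :=
  (IsSES.biprod' X Y).unop.nonempty_iso_biprod (s := biprod.snd.unop) (by rw [← unop_comp]; simp)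

end ShortExact

/-! ### Vanishing of extension groups -/

section ExtVan

variable (A : Type v) [Category.{w} A] [Abelian A]

/-- The formal properties of the relation `Ext^{n+1}(X, Y) = 0`, written `van n X Y` (note the
shift by one), that follow from the two long exact sequences. They are symmetric in the two
variables, so that the structure can be transported to the opposite category. -/
structure ExtVan where
  van : ℕ → A → A → Prop
  lift {X Y₁ Y₂ Y₃ : A} {f : Y₁ ⟶ Y₂} {g : Y₂ ⟶ Y₃} : IsSES f g → van 0 X Y₁ →
    ∀ k : X ⟶ Y₃, ∃ l, l ≫ g = k
  cov_zero {X Y₁ Y₂ Y₃ : A} {f : Y₁ ⟶ Y₂} {g : Y₂ ⟶ Y₃} : IsSES f g →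
    (∀ k : X ⟶ Y₃, ∃ l, l ≫ g = k) → van 0 X Y₂ → van 0 X Y₁
  cov_left {n : ℕ} {X Y₁ Y₂ Y₃ : A} {f : Y₁ ⟶ Y₂} {g : Y₂ ⟶ Y₃} : IsSES f g →
    van n X Y₃ → van (n + 1) X Y₂ → van (n + 1) X Y₁
  cov_mid {n : ℕ} {X Y₁ Y₂ Y₃ : A} {f : Y₁ ⟶ Y₂} {g : Y₂ ⟶ Y₃} : IsSES f g →
    van n X Y₁ → van n X Y₃ → van n X Y₂
  cov_right {n : ℕ} {X Y₁ Y₂ Y₃ : A} {f : Y₁ ⟶ Y₂} {g : Y₂ ⟶ Y₃} : IsSES f g →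
    van n X Y₂ → van (n + 1) X Y₁ → van n X Y₃
  desc {Y X₁ X₂ X₃ : A} {f : X₁ ⟶ X₂} {g : X₂ ⟶ X₃} : IsSES f g → van 0 X₃ Y →
    ∀ k : X₁ ⟶ Y, ∃ l, f ≫ l = k
  contra_zero {Y X₁ X₂ X₃ : A} {f : X₁ ⟶ X₂} {g : X₂ ⟶ X₃} : IsSES f g →
    (∀ k : X₁ ⟶ Y, ∃ l, f ≫ l = k) → van 0 X₂ Y → van 0 X₃ Y
  contra_left {n : ℕ} {Y X₁ X₂ X₃ : A} {f : X₁ ⟶ X₂} {g : X₂ ⟶ X₃} : IsSES f g →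
    van n X₂ Y → van (n + 1) X₃ Y → van n X₁ Y
  contra_mid {n : ℕ} {Y X₁ X₂ X₃ : A} {f : X₁ ⟶ X₂} {g : X₂ ⟶ X₃} : IsSES f g →
    van n X₁ Y → van n X₃ Y → van n X₂ Y
  contra_right {n : ℕ} {Y X₁ X₂ X₃ : A} {f : X₁ ⟶ X₂} {g : X₂ ⟶ X₃} : IsSES f g →
    van n X₁ Y → van (n + 1) X₂ Y → van (n + 1) X₃ Y

variable {A}

/-- The same relation with the variables exchanged, in the opposite category. -/
def ExtVan.op (E : ExtVan A) : ExtVan Aᵒᵖ where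
  van n X Y := E.van n Y.unop X.unop
  lift h hv k := by
    obtain ⟨l, hl⟩ := E.desc h.unop hv k.unop
    exact ⟨l.op, Quiver.Hom.unop_inj hl⟩
  desc h hv k := by
    obtain ⟨l, hl⟩ := E.lift h.unop hv k.unop
    exact ⟨l.op, Quiver.Hom.unop_inj hl⟩
  cov_zero h hk hv := E.contra_zero h.unop (fun k => by
    obtain ⟨l, hl⟩ := hk k.op
    exact ⟨l.unop, Quiver.Hom.op_inj hl⟩) hv
  contra_zero h hk hv := E.cov_zero h.unop (fun k => by
    obtain ⟨l, hl⟩ := hk k.op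
    exact ⟨l.unop, Quiver.Hom.op_inj hl⟩) hv
  cov_left h := E.contra_right h.unop
  cov_mid h h₁ h₃ := E.contra_mid h.unop h₃ h₁
  cov_right h := E.contra_left h.unop
  contra_left h := E.cov_right h.unop
  contra_mid h h₁ h₃ := E.cov_mid h.unop h₃ h₁
  contra_right h := E.cov_left h.unop

open Abelian in
/-- The vanishing relation of the `Ext` groups. -/
def extVan (A : Type v) [Category.{w} A] [Abelian A] [HasExt.{x} A] : ExtVan A where
  van n X Y := Subsingleton (Ext.{x} X Y (n + 1))
  lift h hv k := by
    obtain ⟨l, hl⟩ := Ext.covariant_sequence_exact₃ _ h.2 (Ext.mk₀ k) rfl (Subsingleton.elim _ _)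
    obtain ⟨l, rfl⟩ := (Ext.mk₀_bijective _ _).2 l
    exact ⟨l, (Ext.mk₀_bijective _ _).1 (by simpa using hl)⟩
  cov_zero h hk hv := by
    refine subsingleton_of_forall_eq 0 fun e => ?_
    obtain ⟨l, rfl⟩ := Ext.covariant_sequence_exact₁ _ h.2 e (Subsingleton.elim _ _) rfl
    obtain ⟨l, rfl⟩ := (Ext.mk₀_bijective _ _).2 l
    obtain ⟨m, rfl⟩ := hk l
    rw [← Ext.mk₀_comp_mk₀, Ext.comp_assoc_of_second_deg_zero, h.2.comp_extClass, Ext.comp_zero]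
  cov_left h h₃ h₂ := by
    refine subsingleton_of_forall_eq 0 fun e => ?_
    obtain ⟨l, rfl⟩ := Ext.covariant_sequence_exact₁ _ h.2 e (Subsingleton.elim _ _) rfl
    rw [Subsingleton.elim l 0, Ext.zero_comp]
  cov_mid h h₁ h₃ := by
    refine subsingleton_of_forall_eq 0 fun e => ?_
    obtain ⟨l, rfl⟩ := Ext.covariant_sequence_exact₂ _ h.2 e (Subsingleton.elim _ _)
    rw [Subsingleton.elim l 0, Ext.zero_comp]
  cov_right h h₂ h₁ := by
    refine subsingleton_of_forall_eq 0 fun e => ?_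
    obtain ⟨l, rfl⟩ := Ext.covariant_sequence_exact₃ _ h.2 e rfl (Subsingleton.elim _ _)
    rw [Subsingleton.elim l 0, Ext.zero_comp]
  desc h hv k := by
    obtain ⟨l, hl⟩ := Ext.contravariant_sequence_exact₁ h.2 _ (Ext.mk₀ k) rfl
      (Subsingleton.elim _ _)
    obtain ⟨l, rfl⟩ := (Ext.mk₀_bijective _ _).2 l
    exact ⟨l, (Ext.mk₀_bijective _ _).1 (by simpa using hl)⟩
  contra_zero h hk hv := by
    refine subsingleton_of_forall_eq 0 fun e => ?_
    obtain ⟨l, rfl⟩ := Ext.contravariant_sequence_exact₃ h.2 _ e (Subsingleton.elim _ _)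
      (add_comm _ _)
    obtain ⟨l, rfl⟩ := (Ext.mk₀_bijective _ _).2 l
    obtain ⟨m, rfl⟩ := hk l
    rw [← Ext.mk₀_comp_mk₀, ← Ext.comp_assoc_of_second_deg_zero, h.2.extClass_comp, Ext.zero_comp]
  contra_left h h₂ h₃ := by
    refine subsingleton_of_forall_eq 0 fun e => ?_
    obtain ⟨l, rfl⟩ := Ext.contravariant_sequence_exact₁ h.2 _ e (add_comm _ _)
      (Subsingleton.elim _ _)
    rw [Subsingleton.elim l 0, Ext.comp_zero]
  contra_mid h h₁ h₃ := by
    refine subsingleton_of_forall_eq 0 fun e => ?_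
    obtain ⟨l, rfl⟩ := Ext.contravariant_sequence_exact₂ h.2 _ e (Subsingleton.elim _ _)
    rw [Subsingleton.elim l 0, Ext.comp_zero]
  contra_right h h₁ h₂ := by
    refine subsingleton_of_forall_eq 0 fun e => ?_
    obtain ⟨l, rfl⟩ := Ext.contravariant_sequence_exact₃ h.2 _ e (Subsingleton.elim _ _)
      (add_comm _ _)
    rw [Subsingleton.elim l 0, Ext.comp_zero]

end ExtVan

/-! ### Sequences built by dependent choice -/

lemma exists_nat_seq {α : Type*} {Q : ℕ → α → Prop} {R : ℕ → α → α → Prop}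
    (h : ∀ n x, Q n x → ∃ y, Q (n + 1) y ∧ R n y x) {a : α} (ha : Q 0 a) :
    ∃ f : ℕ → α, f 0 = a ∧ ∀ n, Q n (f n) ∧ R n (f (n + 1)) (f n) := by
  choose! g hg using h
  let f : ℕ → α := fun n => Nat.rec a (fun n x => g n x) n
  have hf : ∀ n, Q n (f n) := fun n => by
    induction n with
    | zero => exact ha
    | succ n ih => exact (hg n _ ih).1
  exact ⟨f, rfl, fun n => ⟨hf n, (hg n _ (hf n)).2⟩⟩

/-- Dependent choice in both directions: `R n` relates the term in degree `n + 1` to the term in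
degree `n`. -/
lemma exists_int_seq {α : Type*} {Q : ℤ → α → Prop} {R : ℤ → α → α → Prop}
    (hl : ∀ n : ℤ, 0 ≤ n → ∀ x, Q n x → ∃ y, Q (n + 1) y ∧ R n y x)
    (hr : ∀ n : ℤ, n < 0 → ∀ x, Q (n + 1) x → ∃ y, Q n y ∧ R n x y) {a : α} (ha : Q 0 a) :
    ∃ f : ℤ → α, f 0 = a ∧ ∀ n, Q n (f n) ∧ R n (f (n + 1)) (f n) := by
  obtain ⟨f, hf0, hf⟩ := exists_nat_seq (Q := fun n => Q n) (R := fun n => R n) (a := a)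
    (fun n x hx => by exact_mod_cast hl n (by positivity) x hx) (by simpa using ha)
  obtain ⟨g, hg0, hg⟩ := exists_nat_seq (Q := fun n => Q (-n)) (R := fun n y x => R (-n - 1) x y)
    (a := a) (fun n x hx => by
      obtain ⟨y, hy⟩ := hr (-n - 1) (by omega) x (by simpa using hx)
      refine ⟨y, ?_, hy.2⟩
      convert hy.1 using 1
      push_cast; ring) (by simpa using ha)
  refine ⟨fun n => if 0 ≤ n then f n.toNat else g (-n).toNat, by simpa using hf0, fun n => ?_⟩
  obtain ⟨m, rfl | rfl⟩ := n.eq_nat_or_neg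
  · have h1 : (0 : ℤ) ≤ (m : ℤ) + 1 := by positivity
    have h2 : ((m : ℤ) + 1).toNat = m + 1 := by omega
    simp only [Nat.cast_nonneg, h1, h2, if_true, Int.toNat_natCast]
    exact hf m
  · obtain - | m := m
    · simpa using hf 0
    · have h1 : ¬ (0 : ℤ) ≤ -((m + 1 : ℕ) : ℤ) := by push_cast; omega
      have h2 : (- -((m + 1 : ℕ) : ℤ)).toNat = m + 1 := by omega
      have h3 : -((m + 1 : ℕ) : ℤ) = -(m : ℤ) - 1 := by push_cast; ring
      simp only [h1, if_false, h2]
      refine ⟨(hg (m + 1)).1, ?_⟩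
      have := (hg m).2
      rw [h3]
      convert this using 1
      obtain - | m := m
      · simp [hf0, hg0]
      · have h4 : ¬ (0 : ℤ) ≤ -((m + 1 : ℕ) : ℤ) - 1 + 1 := by push_cast; omega
        rw [if_neg h4]
        congr 1

section

variable {A : Type v} [Category.{w} A] [Abelian A]

/-! ### Objects with a two-sided resolution -/

section Gorenstein

/-- `X'` is the kernel of an epimorphism `T ⟶ X` with `T` in `W`, and the resulting short exact
sequence stays exact under `Hom(U, -)` and `Hom(-, U)` for all `U` in `W`. -/
def IsStep (W : ObjectProperty A) (X' X : A) : Prop :=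
  ∃ (T : A) (i : X' ⟶ T) (p : T ⟶ X), IsSES i p ∧ W T ∧
    (∀ U, W U → ∀ f : U ⟶ X, ∃ g, g ≫ p = f) ∧ (∀ U, W U → ∀ f : X' ⟶ U, ∃ g, i ≫ g = f)

/-- `M` is a term of a sequence of objects indexed by `ℤ` in which consecutive terms are related
by `IsStep`. The objects of the sequence are the syzygies of a totally `W`-acyclic complex, and
this condition, unlike `Gor`, is visibly the largest solution of its own unfolding. -/
def IsGor (W : ObjectProperty A) : ObjectProperty A := fun M =>
  ∃ Z : ℤ → A, Z 0 = M ∧ ∀ n, IsStep W (Z (n + 1)) (Z n)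

variable {W : ObjectProperty A}

lemma IsStep.op {X' X : A} (h : IsStep W X' X) : IsStep W.op (.op X) (.op X') := by
  obtain ⟨T, i, p, h, hT, h₁, h₂⟩ := h
  refine ⟨.op T, p.op, i.op, h.op, hT, fun U hU f => ?_, fun U hU f => ?_⟩
  · obtain ⟨g, hg⟩ := h₂ _ hU f.unop
    exact ⟨g.op, Quiver.Hom.unop_inj hg⟩
  · obtain ⟨g, hg⟩ := h₁ _ hU f.unop
    exact ⟨g.op, Quiver.Hom.unop_inj hg⟩

lemma IsStep.unop {X' X : Aᵒᵖ} (h : IsStep W.op X' X) : IsStep W X.unop X'.unop := by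
  obtain ⟨T, i, p, h, hT, h₁, h₂⟩ := h
  refine ⟨T.unop, p.unop, i.unop, h.unop, hT, fun U hU f => ?_, fun U hU f => ?_⟩
  · obtain ⟨g, hg⟩ := h₂ (.op U) hU f.op
    exact ⟨g.unop, Quiver.Hom.op_inj hg⟩
  · obtain ⟨g, hg⟩ := h₁ (.op U) hU f.op
    exact ⟨g.unop, Quiver.Hom.op_inj hg⟩

lemma IsGor.op {M : A} (h : IsGor W M) : IsGor W.op (.op M) := by
  obtain ⟨Z, hZ, h⟩ := h
  refine ⟨fun n => .op (Z (-n)), by simp [hZ], fun n => ?_⟩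
  have := (h (-(n + 1))).op
  rwa [show -(n + 1) + 1 = -n by ring] at this

lemma IsGor.unop {M : Aᵒᵖ} (h : IsGor W.op M) : IsGor W M.unop := by
  obtain ⟨Z, hZ, h⟩ := h
  refine ⟨fun n => (Z (-n)).unop, by simp [hZ], fun n => ?_⟩
  have := (h (-(n + 1))).unop
  rwa [show -(n + 1) + 1 = -n by ring] at this

lemma isGor_op : IsGor W.op = (IsGor W).op := by
  ext M
  exact ⟨fun h => h.unop, fun h => IsGor.op (M := M.unop) h⟩

lemma IsGor.shift {Z : ℤ → A} (h : ∀ n, IsStep W (Z (n + 1)) (Z n)) (m : ℤ) : IsGor W (Z m) :=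
  ⟨fun n => Z (n + m), by simp, fun n => by
    have := h (n + m)
    rwa [show n + m + 1 = n + 1 + m by ring] at this⟩

lemma IsGor.exists_left {M : A} (h : IsGor W M) : ∃ M', IsGor W M' ∧ IsStep W M' M := by
  obtain ⟨Z, rfl, h⟩ := h
  exact ⟨_, .shift h 1, h 0⟩

lemma IsGor.exists_right {M : A} (h : IsGor W M) : ∃ M', IsGor W M' ∧ IsStep W M M' := by
  obtain ⟨Z, rfl, h⟩ := h
  exact ⟨_, .shift h (-1), by simpa using h (-1)⟩

/-- The coinduction principle: `IsGor W` contains every class that unfolds in both directions. -/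
lemma IsGor.coind (S : ObjectProperty A) (hl : ∀ X, S X → ∃ Y, S Y ∧ IsStep W Y X)
    (hr : ∀ X, S X → ∃ Y, S Y ∧ IsStep W X Y) : S ≤ IsGor W := by
  intro M hM
  obtain ⟨Z, hZ, h⟩ := exists_int_seq (Q := fun _ => S) (R := fun _ => IsStep W)
    (fun _ _ => hl) (fun _ _ => hr) hM
  exact ⟨Z, hZ, fun n => (h n).2⟩

lemma IsStep.of_iso {X' X Y : A} (h : IsStep W X' X) (e : X ≅ Y) : IsStep W X' Y := by
  obtain ⟨T, i, p, h, hT, h₁, h₂⟩ := h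
  refine ⟨T, i, p ≫ e.hom, h.comp_iso e, hT, fun U hU f => ?_, h₂⟩
  obtain ⟨g, hg⟩ := h₁ U hU (f ≫ e.inv)
  exact ⟨g, by rw [← Category.assoc, hg]; simp⟩

lemma IsGor.of_iso {X Y : A} (h : IsGor W X) (e : X ≅ Y) : IsGor W Y := by
  refine IsGor.coind (W := W) (fun Y => ∃ X, IsGor W X ∧ Nonempty (X ≅ Y)) ?_ ?_ _ ⟨X, h, ⟨e⟩⟩
  · rintro Y ⟨X, hX, ⟨e⟩⟩
    obtain ⟨X', hX', h⟩ := hX.exists_left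
    exact ⟨X', ⟨X', hX', ⟨.refl _⟩⟩, h.of_iso e⟩
  · rintro Y ⟨X, hX, ⟨e⟩⟩
    obtain ⟨X', hX', h⟩ := hX.exists_right
    exact ⟨X', ⟨X', hX', ⟨.refl _⟩⟩, (h.op.of_iso e.symm.op).unop⟩

lemma IsSubcategory.op (hW : IsSubcategory W) : IsSubcategory W.op where
  zero X hX := hW.zero _ hX.unop
  iso e h := hW.iso e.symm.unop h
  biprod X Y hX hY := by
    obtain ⟨e⟩ := nonempty_unop_biprod_iso X Y
    exact hW.iso e.symm (hW.biprod _ _ hX hY)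

open ZeroObject in
lemma IsSubcategory.le_isGor (hW : IsSubcategory W) : W ≤ IsGor W := by
  have hO : IsZero (0 : A) := isZero_zero A
  refine IsGor.coind W (fun X hX => ⟨0, hW.zero _ hO, X, _, _, .zero_id hO X, hX, ?_, ?_⟩)
    (fun X hX => ⟨0, hW.zero _ hO, X, _, _, .id_zero hO X, hX, ?_, ?_⟩)
  · exact fun U _ f => ⟨f, by simp⟩
  · exact fun U _ f => ⟨0, hO.eq_of_src _ _⟩
  · exact fun U _ f => ⟨0, hO.eq_of_tgt _ _⟩
  · exact fun U _ f => ⟨f, by simp⟩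

/-- All extension groups of positive degree between objects of `W` vanish. -/
def ExtVan.Orth (E : ExtVan A) (W : ObjectProperty A) : Prop :=
  ∀ n X Y, W X → W Y → E.van n X Y

variable {E : ExtVan A}

lemma ExtVan.Orth.op (hE : E.Orth W) : E.op.Orth W.op := fun n _ _ hX hY => hE n _ _ hY hX

/-- An object of `IsGor W` has an arbitrarily long coresolution by objects of `W` that remains exact
under `Hom(U, -)`, so dimension shifting applies. -/
lemma ExtVan.Orth.van_isGor (hE : E.Orth W) {U X : A} (hU : W U) (hX : IsGor W X) (n : ℕ) :
    E.van n U X := by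
  induction n generalizing X with
  | zero =>
    obtain ⟨X', -, T, i, p, h, hT, hl, -⟩ := hX.exists_right
    exact E.cov_zero h (hl U hU) (hE _ _ _ hU hT)
  | succ n ih =>
    obtain ⟨X', hX', T, i, p, h, hT, -⟩ := hX.exists_right
    exact E.cov_left h (ih hX') (hE _ _ _ hU hT)

lemma ExtVan.Orth.isGor_van (hE : E.Orth W) {U X : A} (hU : W U) (hX : IsGor W X) (n : ℕ) :
    E.van n X U :=
  hE.op.van_isGor (U := .op U) hU hX.op n

/-- A short exact sequence with middle term in `W` and suitable vanishing of `Ext¹` is a step. -/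
lemma IsStep.of_van {X' X T : A} {i : X' ⟶ T} {p : T ⟶ X} (h : IsSES i p) (hT : W T)
    (h₁ : ∀ U, W U → E.van 0 U X') (h₂ : ∀ U, W U → E.van 0 X U) : IsStep W X' X :=
  ⟨T, i, p, h, hT, fun U hU => E.lift h (h₁ U hU), fun U hU => E.desc h (h₂ U hU)⟩

/-- The class of extensions of objects of `IsGor W` by such objects unfolds to the left. -/
lemma exists_left_of_extension (hW : IsSubcategory W) (hE : E.Orth W) {X Y Z : A} {f : X ⟶ Y}
    {g : Y ⟶ Z} (h : IsSES f g) (hX : IsGor W X) (hZ : IsGor W Z) :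
    ∃ Y', (∃ (X' Z' : A) (f' : X' ⟶ Y') (g' : Y' ⟶ Z'), IsSES f' g' ∧ IsGor W X' ∧ IsGor W Z') ∧
      IsStep W Y' Y := by
  obtain ⟨X', hX', TX, i, p, hx, hTX, -⟩ := hX.exists_left
  obtain ⟨Z', hZ', TZ, j, q, hz, hTZ, -⟩ := hZ.exists_left
  obtain ⟨Y', f', g', k, r, h', hy⟩ := h.horseshoe hx hz (E.lift h (hE.van_isGor hTZ hX 0) _)
  exact ⟨Y', ⟨X', Z', f', g', h', hX', hZ'⟩, .of_van (E := E) hy (hW.biprod _ _ hTX hTZ)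
    (fun U hU => E.cov_mid h' (hE.van_isGor hU hX' 0) (hE.van_isGor hU hZ' 0))
    (fun U hU => E.contra_mid h (hE.isGor_van hU hX 0) (hE.isGor_van hU hZ 0))⟩

lemma IsGor.extension (hW : IsSubcategory W) (hE : E.Orth W) {X Y Z : A} {f : X ⟶ Y}
    {g : Y ⟶ Z} (h : IsSES f g) (hX : IsGor W X) (hZ : IsGor W Z) : IsGor W Y := by
  refine IsGor.coind (W := W)
    (fun Y => ∃ (X Z : A) (f : X ⟶ Y) (g : Y ⟶ Z), IsSES f g ∧ IsGor W X ∧ IsGor W Z) ?_ ?_ _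
    ⟨X, Z, f, g, h, hX, hZ⟩
  · rintro Y ⟨X, Z, f, g, h, hX, hZ⟩
    exact exists_left_of_extension hW hE h hX hZ
  · rintro Y ⟨X, Z, f, g, h, hX, hZ⟩
    obtain ⟨Y', ⟨X', Z', f', g', h', hX', hZ'⟩, hY⟩ :=
      exists_left_of_extension hW.op hE.op h.op hZ.op hX.op
    exact ⟨Y'.unop, ⟨_, _, _, _, h'.unop, hZ'.unop, hX'.unop⟩, hY.unop⟩

lemma IsGor.biprod (hW : IsSubcategory W) (hE : E.Orth W) {X Y : A} (hX : IsGor W X)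
    (hY : IsGor W Y) : IsGor W (X ⊞ Y) := .extension hW hE (.biprod X Y) hX hY

/-- The class of direct summands of objects of `IsGor W` unfolds to the left. -/
lemma exists_left_of_summand (hW : IsSubcategory W) (hE : E.Orth W) {X Y : A}
    (h : IsGor W (X ⊞ Y)) : ∃ X', (∃ Y', IsGor W (X' ⊞ Y')) ∧ IsStep W X' X := by
  obtain ⟨L, hL, T, i, p, hp, hT, hl, -⟩ := h.exists_left
  obtain ⟨K₁, K₂, k₁, k₂, j, h₁, h₂, hj⟩ := hp.exists_kernels_biprod
  refine ⟨K₁, ⟨K₂, .extension hW hE hj hL (hW.le_isGor _ hT)⟩, T, k₁, _, h₁, hT, ?_, ?_⟩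
  · intro U hU f
    obtain ⟨g, hg⟩ := hl U hU (f ≫ biprod.inl)
    exact ⟨g, by rw [← Category.assoc, hg]; simp⟩
  · exact fun U hU => E.desc h₁ (E.contra_zero (.biprod' X Y) (fun k => ⟨biprod.snd ≫ k, by simp⟩)
      (hE.isGor_van hU h 0))

lemma IsGor.summand (hW : IsSubcategory W) (hE : E.Orth W) {X Y : A} (h : IsGor W (X ⊞ Y)) :
    IsGor W X := by
  refine IsGor.coind (W := W) (fun X => ∃ Y, IsGor W (X ⊞ Y)) ?_ ?_ _ ⟨Y, h⟩
  · rintro X ⟨Y, h⟩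
    exact exists_left_of_summand hW hE h
  · rintro X ⟨Y, h⟩
    obtain ⟨e⟩ := nonempty_op_biprod_iso X Y
    obtain ⟨X', ⟨Y', h'⟩, hX'⟩ := exists_left_of_summand hW.op hE.op (h.op.of_iso e)
    obtain ⟨e'⟩ := nonempty_unop_biprod_iso X' Y'
    exact ⟨X'.unop, ⟨Y'.unop, h'.unop.of_iso e'⟩, hX'.unop⟩

end Gorenstein

/-! ### Objects of finite dimension -/

section FiniteDimension

/-- `M` has a `W`-resolution whose `n`-th syzygy satisfies `IsGor W`. -/
def SyzygyGor (W : ObjectProperty A) : ℕ → ObjectProperty A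
  | 0 => IsGor W
  | n + 1 => fun M => ∃ (M' U : A) (i : M' ⟶ U) (p : U ⟶ M), IsSES i p ∧ W U ∧ SyzygyGor W n M'

variable {W : ObjectProperty A} {E : ExtVan A}

lemma SyzygyGor.of_iso {n : ℕ} {X Y : A} (h : SyzygyGor W n X) (e : X ≅ Y) : SyzygyGor W n Y := by
  cases n with
  | zero => exact IsGor.of_iso h e
  | succ n =>
    obtain ⟨M', U, i, p, h, hU, hM'⟩ := h
    exact ⟨M', U, i, _, h.comp_iso e, hU, hM'⟩

lemma SyzygyGor.exists_cover {n : ℕ} {M : A} (h : SyzygyGor W n M) :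
    ∃ (M' U : A) (i : M' ⟶ U) (p : U ⟶ M), IsSES i p ∧ W U ∧ SyzygyGor W (n - 1) M' := by
  cases n with
  | zero =>
    obtain ⟨M', hM', T, i, p, h, hT, -⟩ := IsGor.exists_left h
    exact ⟨M', T, i, p, h, hT, hM'⟩
  | succ n => exact h

lemma SyzygyGor.succ {n : ℕ} {M : A} (h : SyzygyGor W n M) : SyzygyGor W (n + 1) M := by
  induction n generalizing M with
  | zero => exact h.exists_cover
  | succ n ih =>
    obtain ⟨M', U, i, p, h, hU, hM'⟩ := h
    exact ⟨M', U, i, p, h, hU, ih hM'⟩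

lemma SyzygyGor.mono {m n : ℕ} (hmn : m ≤ n) {M : A} (h : SyzygyGor W m M) : SyzygyGor W n M :=
  Nat.le_induction h (fun _ _ ih => ih.succ) n hmn

lemma SyzygyGor.van (hE : E.Orth W) {n : ℕ} {M U : A} (h : SyzygyGor W n M) (hU : W U) (m : ℕ) :
    E.van m U M := by
  induction n generalizing M m with
  | zero => exact hE.van_isGor hU h m
  | succ n ih =>
    obtain ⟨M', T, i, p, h, hT, hM'⟩ := h
    exact E.cov_right h (hE _ _ _ hU hT) (ih hM' _)

lemma SyzygyGor.extension (hW : IsSubcategory W) (hE : E.Orth W) {n : ℕ} {X Y Z : A} {f : X ⟶ Y}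
    {g : Y ⟶ Z} (h : IsSES f g) (hX : SyzygyGor W n X) (hZ : SyzygyGor W n Z) :
    SyzygyGor W n Y := by
  induction n generalizing X Y Z with
  | zero => exact IsGor.extension hW hE h hX hZ
  | succ n ih =>
    obtain ⟨X', TX, i, p, hx, hTX, hX'⟩ := id hX
    obtain ⟨Z', TZ, j, q, hz, hTZ, hZ'⟩ := hZ
    obtain ⟨Y', f', g', k, r, h', hy⟩ := h.horseshoe hx hz (E.lift h (hX.van hE hTZ 0) _)
    exact ⟨Y', _, k, r, hy, hW.biprod _ _ hTX hTZ, ih h' hX' hZ'⟩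

lemma SyzygyGor.summand (hW : IsSubcategory W) (hE : E.Orth W) {n : ℕ} {X Y : A}
    (h : SyzygyGor W n (X ⊞ Y)) : SyzygyGor W n X := by
  induction n generalizing X Y with
  | zero => exact IsGor.summand hW hE h
  | succ n ih =>
    obtain ⟨L, T, i, p, hp, hT, hL⟩ := h
    obtain ⟨K₁, K₂, k₁, k₂, j, h₁, h₂, hj⟩ := hp.exists_kernels_biprod
    have hT' : SyzygyGor W n T := SyzygyGor.mono (Nat.zero_le n) (hW.le_isGor _ hT)
    exact ⟨K₁, T, k₁, _, h₁, hT, ih (.extension hW hE hj hL hT')⟩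

/-- The objects some syzygy of which satisfies `IsGor W`. -/
def EventuallyGor (W : ObjectProperty A) : ObjectProperty A := fun M => ∃ n, SyzygyGor W n M

lemma EventuallyGor.extension (hW : IsSubcategory W) (hE : E.Orth W) {X Y Z : A} {f : X ⟶ Y}
    {g : Y ⟶ Z} (h : IsSES f g) (hX : EventuallyGor W X) (hZ : EventuallyGor W Z) :
    EventuallyGor W Y := by
  obtain ⟨m, hX⟩ := hX
  obtain ⟨n, hZ⟩ := hZ
  exact ⟨_, .extension hW hE h (hX.mono (le_max_left m n)) (hZ.mono (le_max_right m n))⟩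

/-- Let `U ⟶ Y` be a cover by an object of `W` with kernel `Y'`. The kernel of `U ⟶ Y ⟶ Z` is an
extension of `X` by `Y'`, and it is a syzygy of `Z`. -/
lemma EventuallyGor.cokernel (hW : IsSubcategory W) (hE : E.Orth W) {X Y Z : A} {f : X ⟶ Y}
    {g : Y ⟶ Z} (h : IsSES f g) (hX : EventuallyGor W X) (hY : EventuallyGor W Y) :
    EventuallyGor W Z := by
  obtain ⟨n, hY⟩ := hY
  obtain ⟨Y', U, i, p, hp, hU, hY'⟩ := hY.exists_cover
  obtain ⟨K, k, f', g', hk, hK⟩ := hp.exists_kernel_comp h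
  obtain ⟨m, hm⟩ := EventuallyGor.extension hW hE hK ⟨_, hY'⟩ hX
  exact ⟨m + 1, K, U, k, _, hk, hU, hm⟩

/-- An epimorphism onto an object of `W` is split if its source has a cover by an object of `W`:
the kernel of the composite lies in `W`, hence the composite is split. -/
lemma EventuallyGor.exists_section (hE : E.Orth W) (hK : ClosedUnderKernelsOfEpis W) {P U : A}
    (hP : EventuallyGor W P) (hU : W U) (f : P ⟶ U) [Epi f] : ∃ s, s ≫ f = 𝟙 U := by
  obtain ⟨n, hP⟩ := hP
  obtain ⟨P', T, i, p, hp, hT, -⟩ := hP.exists_cover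
  have := hp.epi
  have h := IsSES.of_epi (p ≫ f)
  obtain ⟨s, hs⟩ := E.lift h (hE _ _ _ hU (hK _ h.2 hT hU)) (𝟙 U)
  exact ⟨s ≫ p, by simpa using hs⟩

/-- The pullback of `Y ⟶ Z` along a cover `U ⟶ Z` is an extension of `Y` by a syzygy of `Z`. Its
projection to `U` is split with kernel `X`, so `X` is a direct summand of it. -/
lemma EventuallyGor.kernel (hW : IsSubcategory W) (hE : E.Orth W)
    (hK : ClosedUnderKernelsOfEpis W) {X Y Z : A} {f : X ⟶ Y}
    {g : Y ⟶ Z} (h : IsSES f g) (hY : EventuallyGor W Y) (hZ : EventuallyGor W Z) :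
    EventuallyGor W X := by
  obtain ⟨n, hZ⟩ := hZ
  obtain ⟨Z', U, i, p, hp, hU, hZ'⟩ := hZ.exists_cover
  have hpb := IsPullback.of_hasPullback g p
  obtain ⟨i', hi', -⟩ := hp.of_isPullback hpb.flip
  obtain ⟨j, hj, -⟩ := h.of_isPullback hpb
  have hP := EventuallyGor.extension hW hE hi' ⟨_, hZ'⟩ hY
  have := hj.epi
  obtain ⟨s, hs⟩ := hP.exists_section hE hK hU (pullback.snd g p)
  obtain ⟨e⟩ := hj.nonempty_iso_biprod hs
  obtain ⟨m, hm⟩ := hP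
  exact ⟨m, .summand hW hE (hm.of_iso e)⟩

lemma EventuallyGor.twoOfThree (hW : IsSubcategory W) (hE : E.Orth W)
    (hK : ClosedUnderKernelsOfEpis W) : TwoOfThree (EventuallyGor W) where
  extensions S hS := .extension hW hE ⟨S.zero, hS⟩
  kernels S hS := .kernel hW hE hK ⟨S.zero, hS⟩
  cokernels S hS := .cokernel hW hE ⟨S.zero, hS⟩

lemma EventuallyGor.summands (hW : IsSubcategory W) (hE : E.Orth W) :
    ClosedUnderSummands (EventuallyGor W) :=
  fun _ _ ⟨n, h⟩ => ⟨n, .summand hW hE h⟩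

end FiniteDimension

end

/-! ### Exactness of complexes in terms of morphisms -/

section Complexes

variable {A : Type v} [Category.{w} A] [Abelian A]

lemma exactAt_coyoneda_iff {ι : Type*} {c : ComplexShape ι} (K : HomologicalComplex A c) (U : A)
    {i j k : ι} (hi : c.prev j = i) (hk : c.next j = k) :
    (((preadditiveCoyoneda.obj (Opposite.op U)).mapHomologicalComplex c).obj K).ExactAt j ↔
      ∀ f : U ⟶ K.X j, f ≫ K.d j k = 0 → ∃ g : U ⟶ K.X i, g ≫ K.d i j = f := by
  rw [HomologicalComplex.exactAt_iff' _ i j k hi hk, ShortComplex.ab_exact_iff]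
  rfl

lemma exactAt_yoneda_iff {ι : Type*} {c : ComplexShape ι} (K : HomologicalComplex A c) (U : A)
    {i j k : ι} (hi : c.prev j = i) (hk : c.next j = k) :
    (((preadditiveYoneda.obj U).mapHomologicalComplex c.symm).obj K.op).ExactAt j ↔
      ∀ f : K.X j ⟶ U, K.d i j ≫ f = 0 → ∃ g : K.X k ⟶ U, K.d j k ≫ g = f := by
  rw [HomologicalComplex.exactAt_iff' _ k j i (show c.symm.prev j = k from hk)
    (show c.symm.next j = i from hi), ShortComplex.ab_exact_iff]
  rfl

/-- Exactness of `f` and `g` at their common object, in terms of the cokernel of `f`. -/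
lemma IsSES.cokernel_desc {X Y Z : A} {f : X ⟶ Y} {g : Y ⟶ Z} {w : f ≫ g = 0}
    (h : (ShortComplex.mk f g w).Exact) : IsSES (cokernel.desc f g w) (cokernel.π g) := by
  have hm : Mono (cokernel.desc f g w) := h.mono_cokernelDesc
  refine ⟨by ext; simp, .mk' ?_ hm inferInstance⟩
  have h1 := ShortComplex.exact_of_g_is_cokernel (.mk g (cokernel.π g) (cokernel.condition g))
    (cokernelIsCokernel g)
  rw [ShortComplex.exact_iff_exact_up_to_refinements] at h1 ⊢
  intro T x hx
  obtain ⟨T', π, hπ, y, hy⟩ := h1 x hx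
  exact ⟨T', π, hπ, y ≫ cokernel.π f, by simpa using hy⟩

lemma IsSES.exact_comp {X Y Z L D : A} {p : X ⟶ L} {i : L ⟶ Y} {q : Y ⟶ Z}
    (h₁ : Epi p) (h₂ : IsSES i q) {r : Z ⟶ D} (h₃ : Mono r) {f : X ⟶ Y} {g : Y ⟶ D} (hf : f = p ≫ i)
    (hg : g = q ≫ r) (w : f ≫ g = 0) : (ShortComplex.mk f g w).Exact := by
  subst hf hg
  rw [ShortComplex.exact_iff_exact_up_to_refinements]
  intro T x hx
  obtain ⟨l, rfl⟩ := h₂.exists_lift x (by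
    rw [← cancel_mono r, Category.assoc, zero_comp]; exact hx)
  obtain ⟨T', π, hπ, y, hy⟩ := surjective_up_to_refinements_of_epi p l
  exact ⟨T', π, hπ, y, by simp [reassoc_of% hy]⟩

/-! ### Resolutions and sequences of syzygies -/

section Resolutions

variable {P : ObjectProperty A}

lemma acyclic_augment_iff (C : ChainComplex A ℕ) {M : A} (ε : C.X 0 ⟶ M) (w : C.d 1 0 ≫ ε = 0) :
    (C.augment ε w).Acyclic ↔ Epi ε ∧ (ShortComplex.mk _ ε w).Exact ∧
      ∀ n, (ShortComplex.mk (C.d (n + 2) (n + 1)) (C.d (n + 1) n) (by simp)).Exact := by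
  have e0 : (C.augment ε w).ExactAt 0 ↔ Epi ε := by
    rw [HomologicalComplex.exactAt_iff' _ 1 0 0 (by simp) (by simp),
      ShortComplex.exact_iff_epi _ ((C.augment ε w).shape 0 0 (by simp))]
    rfl
  have e1 : (C.augment ε w).ExactAt 1 ↔ (ShortComplex.mk _ ε w).Exact :=
    HomologicalComplex.exactAt_iff' _ 2 1 0 (by simp) (by simp)
  have e2 (n : ℕ) : (C.augment ε w).ExactAt (n + 2) ↔
      (ShortComplex.mk (C.d (n + 2) (n + 1)) (C.d (n + 1) n) (by simp)).Exact :=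
    HomologicalComplex.exactAt_iff' _ (n + 3) (n + 2) (n + 1) (by simp) (by simp)
  simp only [← e0, ← e1, ← e2]
  refine ⟨fun h => ⟨h 0, h 1, fun n => h _⟩, fun ⟨h0, h1, h2⟩ n => ?_⟩
  match n with
  | 0 => exact h0
  | 1 => exact h1
  | n + 2 => exact h2 n

lemma homFromExact_augment_iff (C : ChainComplex A ℕ) {M : A} (ε : C.X 0 ⟶ M)
    (w : C.d 1 0 ≫ ε = 0) : HomFromExact P (C.augment ε w) ↔ ∀ U, P U →
      (∀ f : U ⟶ M, ∃ g, g ≫ ε = f) ∧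
      (∀ f : U ⟶ C.X 0, f ≫ ε = 0 → ∃ g : U ⟶ C.X 1, g ≫ C.d 1 0 = f) ∧
      ∀ n, ∀ f : U ⟶ C.X (n + 1), f ≫ C.d (n + 1) n = 0 →
        ∃ g : U ⟶ C.X (n + 2), g ≫ C.d (n + 2) (n + 1) = f := by
  refine forall₂_congr fun U hU => ?_
  have e0 := exactAt_coyoneda_iff (C.augment ε w) U (i := 1) (j := 0) (k := 0) (by simp) (by simp)
  have e0' : (∀ f : U ⟶ M, ∃ g, g ≫ ε = f) ↔ _ := Iff.trans
    ⟨fun h f _ => h f, fun h f => h f (by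
      rw [(C.augment ε w).shape _ _ (by simp)]; exact comp_zero)⟩ e0.symm
  have e1 := exactAt_coyoneda_iff (C.augment ε w) U (i := 2) (j := 1) (k := 0) (by simp) (by simp)
  have e2 (n : ℕ) := exactAt_coyoneda_iff (C.augment ε w) U (i := n + 3) (j := n + 2) (k := n + 1)
    (by simp) (by simp)
  rw [e0']
  refine ⟨fun h => ⟨h 0, e1.1 (h 1), fun n => (e2 n).1 (h _)⟩, fun ⟨h0, h1, h2⟩ n => ?_⟩
  match n with
  | 0 => exact h0
  | 1 => exact e1.2 h1
  | n + 2 => exact (e2 n).2 (h2 n)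

/-- The resolution obtained by splicing short exact sequences `0 ⟶ Zₙ₊₁ ⟶ Uₙ ⟶ Zₙ ⟶ 0`. -/
noncomputable def Resolution.ofSES (Z U : ℕ → A) (i : ∀ n, Z (n + 1) ⟶ U n) (p : ∀ n, U n ⟶ Z n)
    (h : ∀ n, IsSES (i n) (p n)) (hU : ∀ n, P (U n)) : Resolution P (Z 0) where
  cx := ChainComplex.of U (fun n => p (n + 1) ≫ i n) fun n => by
    simp [reassoc_of% (h (n + 1)).zero]
  ε := p 0
  w := by
    have := ChainComplex.of_d U (fun n => p (n + 1) ≫ i n) 0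
    dsimp at this ⊢
    rw [this, Category.assoc, (h 0).zero, comp_zero]
  mem := hU
  exact := by
    rw [acyclic_augment_iff]
    refine ⟨(h 0).epi, ?_, fun n => ?_⟩
    · exact IsSES.exact_comp (h 1).epi (h 0) (r := 𝟙 _) inferInstance
        (ChainComplex.of_d U (fun n => p (n + 1) ≫ i n) 0) (Category.comp_id _).symm _
    · exact IsSES.exact_comp (h (n + 2)).epi (h (n + 1)) (h n).mono
        (ChainComplex.of_d U (fun n => p (n + 1) ≫ i n) (n + 1))
        (ChainComplex.of_d U (fun n => p (n + 1) ≫ i n) n) _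

lemma Resolution.ofSES_d (Z U : ℕ → A) (i : ∀ n, Z (n + 1) ⟶ U n) (p : ∀ n, U n ⟶ Z n)
    (h : ∀ n, IsSES (i n) (p n)) (hU : ∀ n, P (U n)) (n : ℕ) :
    (ofSES Z U i p h hU).cx.d (n + 1) n = p (n + 1) ≫ i n :=
  ChainComplex.of_d U (fun n => p (n + 1) ≫ i n) n

lemma Resolution.ofSES_isProper (Z U : ℕ → A) (i : ∀ n, Z (n + 1) ⟶ U n) (p : ∀ n, U n ⟶ Z n)
    (h : ∀ n, IsSES (i n) (p n)) (hU : ∀ n, P (U n))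
    (hp : ∀ n T, P T → ∀ f : T ⟶ Z n, ∃ g, g ≫ p n = f) : (ofSES Z U i p h hU).IsProper := by
  refine (homFromExact_augment_iff _ _ _).2 fun T hT => ⟨hp 0 T hT, fun f hf => ?_,
    fun n (f : T ⟶ U (n + 1)) hf => ?_⟩
  · obtain ⟨l, rfl⟩ := (h 0).exists_lift f hf
    obtain ⟨g, rfl⟩ := hp 1 T hT l
    exact ⟨g, (congrArg (g ≫ ·) (ofSES_d Z U i p h hU 0)).trans (Category.assoc _ _ _).symm⟩
  · have := (h n).mono
    have hf' : f ≫ p (n + 1) ≫ i n = 0 :=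
      (congrArg (f ≫ ·) (ofSES_d Z U i p h hU n)).symm.trans hf
    obtain ⟨l, rfl⟩ := (h (n + 1)).exists_lift f (by
      rw [← cancel_mono (i n), zero_comp, Category.assoc, hf'])
    obtain ⟨g, rfl⟩ := hp _ T hT l
    exact ⟨g, (congrArg (g ≫ ·) (ofSES_d Z U i p h hU (n + 1))).trans
      (Category.assoc _ _ _).symm⟩

/-- The short exact sequences of syzygies of a resolution. -/
lemma Resolution.isSES {M : A} (X : Resolution P M) (n : ℕ) :
    IsSES (cokernel.desc (X.cx.d (n + 2) (n + 1)) (X.cx.d (n + 1) n) (by simp))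
      (cokernel.π (X.cx.d (n + 1) n)) :=
  .cokernel_desc (((acyclic_augment_iff _ _ _).1 X.exact).2.2 n)

lemma Resolution.nonempty_iso {M : A} (X : Resolution P M) :
    Nonempty (cokernel (X.cx.d 1 0) ≅ M) := by
  obtain ⟨h0, h1, -⟩ := (acyclic_augment_iff _ _ _).1 X.exact
  have : Epi (ShortComplex.mk _ _ X.w).g := h0
  exact ⟨(cokernelIsCokernel _).coconePointUniqueUpToIso h1.gIsCokernel⟩

lemma projDim_lt_top_iff {M : A} : projDim P M < ⊤ ↔
    ∃ (X : Resolution P M) (n₀ : ℕ), ∀ n, n₀ < n → IsZero (X.cx.X n) := by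
  rw [projDim, iInf_lt_iff]
  refine exists_congr fun X => ⟨fun h => ?_, fun ⟨n₀, h⟩ => ?_⟩
  · obtain ⟨m, hm⟩ := ENat.ne_top_iff_exists.1 h.ne
    refine ⟨m, fun n hn => ?_⟩
    by_contra hz
    have := le_iSup₂ (f := fun (n : ℕ) (_ : ¬ IsZero (X.cx.X n)) => (n : ℕ∞)) n hz
    rw [← hm] at this
    exact absurd (Nat.cast_le.1 this) (by omega)
  · refine lt_of_le_of_lt (iSup₂_le fun n hn => ?_) (ENat.natCast_lt_top n₀)
    exact Nat.cast_le.2 (by by_contra hc; exact hn (h n (by omega)))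

end Resolutions

/-! ### Totally acyclic complexes and sequences of syzygies -/

section Total

variable {W : ObjectProperty A}

/-- The syzygies of a totally acyclic complex form a sequence of steps. -/
lemma TotallyAcyclic.isStep {T : ChainComplex A ℤ} (h : TotallyAcyclic W T) (n : ℤ) :
    IsStep W (cokernel (T.d (n + 1 + 1) (n + 1))) (cokernel (T.d (n + 1) n)) := by
  have hs (m : ℤ) : IsSES (cokernel.desc (T.d (m + 1 + 1) (m + 1)) (T.d (m + 1) m) (by simp))
      (cokernel.π (T.d (m + 1) m)) :=
    .cokernel_desc ((HomologicalComplex.exactAt_iff' _ (m + 1 + 1) (m + 1) m (by simp)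
      (by simp)).1 (h.exact (m + 1)))
  refine ⟨T.X n, _, _, hs n, h.mem n, fun U hU f => ?_, fun U hU f => ?_⟩
  · obtain ⟨m, rfl⟩ : ∃ m, n = m + 1 := ⟨n - 1, by ring⟩
    obtain ⟨k, rfl⟩ : ∃ k, m = k + 1 := ⟨m - 1, by ring⟩
    have := (hs (k + 1)).mono
    have := (hs k).mono
    obtain ⟨g, hg⟩ := (exactAt_coyoneda_iff T U (i := k + 1 + 1) (j := k + 1) (k := k) (by simp)
      (by simp)).1 (h.homFrom U hU _) (f ≫ cokernel.desc _ _ (T.d_comp_d _ _ _)) (by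
        rw [Category.assoc, ← cokernel.π_desc (T.d (k + 1 + 1) (k + 1)) (T.d (k + 1) k) (by simp),
          reassoc_of% (hs (k + 1)).zero]
        simp)
    refine ⟨g, ?_⟩
    rw [← cancel_mono (cokernel.desc _ _ (T.d_comp_d (k + 1 + 1 + 1) (k + 1 + 1) (k + 1))), ← hg]
    simp
  · obtain ⟨g, hg⟩ := (exactAt_yoneda_iff T U (i := n + 1 + 1) (j := n + 1) (k := n) (by simp)
      (by simp)).1 (h.homTo U hU _) (cokernel.π _ ≫ f) (by simp)
    exact ⟨g, by rw [← cancel_epi (cokernel.π _), ← hg]; simp⟩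

lemma TotallyAcyclic.isGor {T : ChainComplex A ℤ} (h : TotallyAcyclic W T) (n : ℤ) :
    IsGor W (cokernel (T.d (n + 1) n)) :=
  .shift (Z := fun n => cokernel (T.d (n + 1) n)) h.isStep n

lemma Gor.isGor {M : A} (h : Gor W M) : IsGor W M := by
  obtain ⟨T, hT, ⟨e⟩⟩ := h
  exact (hT.isGor 0).of_iso e.symm

/-- The complex obtained by splicing short exact sequences `0 ⟶ Zₙ₊₁ ⟶ Tₙ ⟶ Zₙ ⟶ 0`, `n ∈ ℤ`. -/
noncomputable def spliceInt (Z T : ℤ → A) (i : ∀ n, Z (n + 1) ⟶ T n) (p : ∀ n, T n ⟶ Z n)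
    (h : ∀ n, IsSES (i n) (p n)) : ChainComplex A ℤ :=
  ChainComplex.of T (fun n => p (n + 1) ≫ i n) fun n => by
    simp [reassoc_of% (h (n + 1)).zero]

section

variable (Z T : ℤ → A) (i : ∀ n, Z (n + 1) ⟶ T n) (p : ∀ n, T n ⟶ Z n)
    (h : ∀ n, IsSES (i n) (p n))

lemma spliceInt_d (n : ℤ) : (spliceInt Z T i p h).d (n + 1) n = p (n + 1) ≫ i n :=
  ChainComplex.of_d T (fun n => p (n + 1) ≫ i n) n

lemma spliceInt_totallyAcyclic (hT : ∀ n, W (T n))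
    (h₁ : ∀ n U, W U → ∀ f : U ⟶ Z n, ∃ g, g ≫ p n = f)
    (h₂ : ∀ n U, W U → ∀ f : Z (n + 1) ⟶ U, ∃ g, i n ≫ g = f) :
    TotallyAcyclic W (spliceInt Z T i p h) where
  mem := hT
  exact j := by
    obtain ⟨n, rfl⟩ : ∃ n, j = n + 1 := ⟨j - 1, by ring⟩
    rw [HomologicalComplex.exactAt_iff' _ (n + 1 + 1) (n + 1) n (by simp) (by simp)]
    exact IsSES.exact_comp (h (n + 1 + 1)).epi (h (n + 1)) (h n).mono
      (spliceInt_d Z T i p h (n + 1)) (spliceInt_d Z T i p h n) _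
  homFrom U hU j := by
    obtain ⟨n, rfl⟩ : ∃ n, j = n + 1 := ⟨j - 1, by ring⟩
    rw [exactAt_coyoneda_iff _ U (i := n + 1 + 1) (j := n + 1) (k := n) (by simp) (by simp)]
    intro (f : U ⟶ T (n + 1)) hf
    have := (h n).mono
    have hf' : f ≫ p (n + 1) ≫ i n = 0 :=
      (congrArg (f ≫ ·) (spliceInt_d Z T i p h n)).symm.trans hf
    obtain ⟨l, rfl⟩ := (h (n + 1)).exists_lift f (by
      rw [← cancel_mono (i n), zero_comp, Category.assoc, hf'])
    obtain ⟨g, rfl⟩ := h₁ _ U hU l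
    exact ⟨g, (congrArg (g ≫ ·) (spliceInt_d Z T i p h (n + 1))).trans
      (Category.assoc _ _ _).symm⟩
  homTo U hU j := by
    obtain ⟨n, rfl⟩ : ∃ n, j = n + 1 := ⟨j - 1, by ring⟩
    rw [exactAt_yoneda_iff _ U (i := n + 1 + 1) (j := n + 1) (k := n) (by simp) (by simp)]
    intro (f : T (n + 1) ⟶ U) hf
    have := (h (n + 1 + 1)).epi
    have hf' : (p (n + 1 + 1) ≫ i (n + 1)) ≫ f = 0 :=
      (congrArg (· ≫ f) (spliceInt_d Z T i p h (n + 1))).symm.trans hf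
    obtain ⟨l, rfl⟩ := (h (n + 1)).exists_desc f (by
      rw [← cancel_epi (p (n + 1 + 1)), comp_zero, ← hf', Category.assoc])
    obtain ⟨g, rfl⟩ := h₂ _ U hU l
    exact ⟨g, (congrArg (· ≫ g) (spliceInt_d Z T i p h n)).trans (Category.assoc _ _ _)⟩

lemma nonempty_iso_cokernel_spliceInt :
    Nonempty (Z 0 ≅ cokernel ((spliceInt Z T i p h).d 1 0)) := by
  have e : (spliceInt Z T i p h).d 1 0 = p 1 ≫ i 0 := spliceInt_d Z T i p h 0
  have h1 := IsSES.exact_comp (h 1).epi (h 0) (r := 𝟙 _) inferInstance e (g := p 0)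
    (Category.comp_id _).symm (e ▸ by
      exact (Category.assoc _ _ _).trans ((congrArg (p 1 ≫ ·) (h 0).zero).trans comp_zero))
  have : Epi (p 0) := (h 0).epi
  exact ⟨h1.gIsCokernel.coconePointUniqueUpToIso (colimit.isColimit _)⟩

end

lemma IsGor.gor {M : A} (h : IsGor W M) : Gor W M := by
  obtain ⟨Z, rfl, h⟩ := h
  choose T i p h hT h₁ h₂ using h
  exact ⟨spliceInt Z T i p h, spliceInt_totallyAcyclic Z T i p h hT h₁ h₂,
    nonempty_iso_cokernel_spliceInt Z T i p h⟩

lemma gor_eq_isGor : Gor W = IsGor W := by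
  ext M
  exact ⟨Gor.isGor, IsGor.gor⟩

end Total
end Complexes

section
variable {A : Type v} [Category.{w} A] [Abelian A]

/-! ### Tate resolutions -/

section TateRes

variable {W : ObjectProperty A} {E : ExtVan A}

open ZeroObject in
/-- A resolution by objects of `W` can be ended at a syzygy that satisfies `IsGor W`. -/
lemma SyzygyGor.projDim_lt_top (hW : IsSubcategory W) {n : ℕ} {M : A} (h : SyzygyGor W n M) :
    projDim (Gor W) M < ⊤ := by
  rw [gor_eq_isGor]
  obtain ⟨Z, rfl, hZ⟩ := exists_nat_seq
    (Q := fun k Y => (k ≤ n ∧ SyzygyGor W (n - k) Y) ∨ (n < k ∧ IsZero Y))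
    (R := fun k Y' Y => ∃ (U : A) (i : Y' ⟶ U) (p : U ⟶ Y), IsSES i p ∧ IsGor W U ∧
      (n < k → IsZero U)) (a := M) (fun k Y hY => by
      have hO : IsZero (0 : A) := isZero_zero A
      by_cases hk : k < n
      · obtain ⟨hk', hY⟩ | ⟨hk', -⟩ := hY
        · obtain ⟨m, hm⟩ : ∃ m, n - k = m + 1 := ⟨n - k - 1, by omega⟩
          rw [hm] at hY
          obtain ⟨Y', U, i, p, h, hU, hY'⟩ := hY
          refine ⟨Y', .inl ⟨by omega, ?_⟩, U, i, p, h, hW.le_isGor _ hU, fun _ => by omega⟩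
          rwa [show n - (k + 1) = m by omega]
        · omega
      · refine ⟨0, .inr ⟨by omega, hO⟩, Y, _, _, .zero_id hO Y, ?_, fun hk => ?_⟩
        · obtain ⟨hk', hY⟩ | ⟨hk', hY⟩ := hY
          · rwa [show n - k = 0 by omega] at hY
          · exact hW.le_isGor _ (hW.zero _ hY)
        · obtain ⟨hk', hY⟩ | ⟨hk', hY⟩ := hY
          · omega
          · exact hY) (.inl ⟨by simp, h⟩)
  choose hZ U i p h hU hU' using hZ
  exact projDim_lt_top_iff.2 ⟨.ofSES Z U i p h hU, n, hU'⟩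

lemma eventuallyGor_of_projDim_lt_top (hW : IsSubcategory W) (hE : E.Orth W) {M : A}
    (h : projDim (Gor W) M < ⊤) : EventuallyGor W M := by
  obtain ⟨X, n₀, hX⟩ := projDim_lt_top_iff.1 h
  have key (m : ℕ) : ∀ k, n₀ < k + m → EventuallyGor W (cokernel (X.cx.d (k + 1) k)) := by
    induction m with
    | zero =>
      intro k hk
      have hz : IsZero (cokernel (X.cx.d (k + 1) k)) := by
        rw [IsZero.iff_id_eq_zero, ← cancel_epi (cokernel.π _)]
        exact (hX k (by omega)).eq_of_src _ _
      exact ⟨0, hW.le_isGor _ (hW.zero _ hz)⟩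
    | succ m ih =>
      intro k hk
      exact .cokernel hW hE (X.isSES k) (ih (k + 1) (by omega)) ⟨0, (X.mem k).isGor⟩
  obtain ⟨n, hn⟩ := key (n₀ + 1) 0 (by omega)
  obtain ⟨e⟩ := X.nonempty_iso
  exact ⟨n, hn.of_iso e⟩

lemma TateResolution.eventuallyGor {M : A} (t : TateResolution W M) : EventuallyGor W M := by
  obtain ⟨n₀, h₀⟩ := t.eventually_iso
  have key (m : ℕ) : ∀ k, n₀ ≤ k + m → SyzygyGor W m (cokernel (t.W.cx.d (k + 1) k)) := by
    induction m with
    | zero =>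
      intro k hk
      have := h₀ k (by omega)
      have := h₀ (k + 1) (by omega)
      exact (t.totallyAcyclic.isGor k).of_iso (cokernel.mapIso _ _ (asIso (t.α (k + 1)))
        (asIso (t.α k)) (t.comm (k + 1) k).symm)
    | succ m ih =>
      intro k hk
      exact ⟨_, _, _, _, t.W.isSES k, t.W.mem k, ih (k + 1) (by omega)⟩
  obtain ⟨e⟩ := t.W.nonempty_iso
  exact ⟨n₀, (key n₀ 0 (by omega)).of_iso e⟩

/-- The morphism `X'` is a morphism of first syzygies over `X`: there are short exact sequences
`0 ⟶ X'.left ⟶ T ⟶ X.left ⟶ 0` and `0 ⟶ X'.right ⟶ U ⟶ X.right ⟶ 0` with `T` and `U` in `W` and a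
morphism from the first to the second, given by a split epimorphism `T ⟶ U` in the middle. -/
def IsArrowStep (W : ObjectProperty A) (X' X : Arrow A) : Prop :=
  ∃ (T U : A) (i : X'.left ⟶ T) (p : T ⟶ X.left) (j : X'.right ⟶ U) (q : U ⟶ X.right) (α : T ⟶ U),
    IsSES i p ∧ IsSES j q ∧ W T ∧ W U ∧ IsSplitEpi α ∧ i ≫ α = X'.hom ≫ j ∧ p ≫ X.hom = α ≫ q

/-- A morphism from an object of `IsGor W` that becomes an isomorphism after passing `n` times to
syzygies in the sense of `IsArrowStep`. -/
def Approx (W : ObjectProperty A) : ℕ → Arrow A → Prop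
  | 0 => fun X => IsGor W X.left ∧ IsIso X.hom
  | n + 1 => fun X => IsGor W X.left ∧ ∃ X', Approx W n X' ∧ IsArrowStep W X' X

lemma Approx.isGor {n : ℕ} {X : Arrow A} (h : Approx W n X) : IsGor W X.left := by
  cases n <;> exact h.1

lemma Approx.exists_step {n : ℕ} {X : Arrow A} (h : Approx W n X) :
    ∃ X', Approx W (n - 1) X' ∧ IsArrowStep W X' X := by
  cases n with
  | succ n => exact h.2
  | zero =>
    obtain ⟨h, hi⟩ := h
    obtain ⟨Y, hY, T, i, p, hp, hT, -⟩ := h.exists_left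
    exact ⟨Arrow.mk (𝟙 Y), ⟨hY, by dsimp; infer_instance⟩, T, T, i, p, i, p ≫ X.hom, 𝟙 T, hp,
      hp.comp_iso (asIso X.hom), hT, hT, inferInstance, by simp, by simp⟩

lemma Approx.syzygyGor {n : ℕ} {X : Arrow A} (h : Approx W n X) : SyzygyGor W n X.right := by
  induction n generalizing X with
  | zero =>
    obtain ⟨h, hi⟩ := h
    exact IsGor.of_iso h (asIso X.hom)
  | succ n ih =>
    obtain ⟨-, X', hX', T, U, i, p, j, q, α, -, hq, -, hU, -⟩ := h
    exact ⟨X'.right, U, j, q, hq, hU, ih hX'⟩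

/-- Given `φ : Y' ⟶ M'` with `Y'` in `IsGor W` and a short exact sequence `0 ⟶ M' ⟶ U ⟶ M ⟶ 0`,
embed `Y'` into some `H` in `W` with cokernel `Y''`. As `Y' ⟶ M' ⟶ U` extends to `H`, the cokernel
of `Y' ⟶ H ⊞ U` is isomorphic to `Y'' ⊞ U`; the projection of `H ⊞ U` to `U` is the required split
epimorphism. -/
lemma SyzygyGor.exists_approx (hW : IsSubcategory W) (hE : E.Orth W) {n : ℕ} {M : A}
    (h : SyzygyGor W n M) : ∃ X, X.right = M ∧ Approx W n X := by
  induction n generalizing M with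
  | zero => exact ⟨Arrow.mk (𝟙 M), rfl, h, by dsimp; infer_instance⟩
  | succ n ih =>
    obtain ⟨M', U, j, q, hq, hU, hM'⟩ := h
    obtain ⟨X', rfl, hX'⟩ := ih hM'
    obtain ⟨Y'', hY'', H, i, p, hp, hH, -, hext⟩ := hX'.isGor.exists_right
    obtain ⟨c, hc⟩ := hext U hU (X'.hom ≫ j)
    have hs := (hp.biprod_id U).conj_iso (Y' := H ⊞ U)
      ⟨biprod.lift biprod.fst (biprod.fst ≫ c + biprod.snd),
        biprod.lift biprod.fst (biprod.snd - biprod.fst ≫ c), by ext <;> simp, by ext <;> simp⟩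
    obtain ⟨φ, hφ⟩ := hs.exists_desc (biprod.snd ≫ q) (by simp [reassoc_of% hc, hq.zero])
    exact ⟨Arrow.mk φ, rfl, hY''.biprod hW hE (hW.le_isGor _ hU), X', hX', H ⊞ U, U, _, _, j, q,
      biprod.snd, hs, hq, hW.biprod _ _ hH hU, hU, inferInstance, by simp [hc], hφ⟩

/-- Splicing the steps of `Approx` gives the resolution of `X.right` and the nonnegative part of a
totally acyclic complex; the negative part comes from the condition on `X.left`. -/
lemma Approx.exists_tateResolution (hE : E.Orth W) {n : ℕ} {X : Arrow A} (h : Approx W n X) :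
    ∃ t : TateResolution W X.right, ∀ n, IsSplitEpi (t.α n) := by
  obtain ⟨f, rfl, hf⟩ := exists_int_seq
    (Q := fun k Y => IsGor W Y.left ∧ (0 ≤ k → Approx W (n - k.toNat) Y))
    (R := fun k X' X => ∃ (T : A) (i : X'.left ⟶ T) (p : T ⟶ X.left), IsSES i p ∧ W T ∧
      (0 ≤ k → ∃ (U : A) (j : X'.right ⟶ U) (q : U ⟶ X.right) (α : T ⟶ U),
        IsSES j q ∧ W U ∧ IsSplitEpi α ∧ i ≫ α = X'.hom ≫ j ∧ p ≫ X.hom = α ≫ q)) (a := X)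
    (fun k hk Y hY => by
      obtain ⟨X', hX', T, U, i, p, j, q, α, hp, hq, hT, hU, hα, h₁, h₂⟩ := (hY.2 hk).exists_step
      refine ⟨X', ⟨hX'.isGor, fun _ => ?_⟩, T, i, p, hp, hT,
        fun _ => ⟨U, j, q, α, hq, hU, hα, h₁, h₂⟩⟩
      rwa [show n - (k + 1).toNat = n - k.toNat - 1 by omega])
    (fun k hk Y hY => by
      -- in negative degrees only the source of the arrow matters
      obtain ⟨Y', hY', T, i, p, hp, hT, -⟩ := hY.1.exists_right
      exact ⟨Arrow.mk (𝟙 Y'), ⟨hY', fun h => by omega⟩, T, i, p, hp, hT, fun h => by omega⟩)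
    ⟨h.isGor, fun _ => by simpa using h⟩
  have hG (m : ℤ) := (hf m).1.1
  have hS (m : ℕ) : SyzygyGor W (n - m) (f m).right := ((hf m).1.2 (by positivity)).syzygyGor
  have hR (m : ℤ) := (hf m).2
  choose T i p hip hT h₃ using hR
  have hR' (m : ℕ) := h₃ m (by positivity)
  choose U j q α hjq hU hα hiα hpα using hR'
  let Z : ℕ → A := fun m => (f m).right
  have hjq' : ∀ m, IsSES (X := Z (m + 1)) (j m) (q m) := hjq
  refine ⟨⟨spliceInt (fun m => (f m).left) T i p hip,
    spliceInt_totallyAcyclic _ T i p hip hT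
      (fun m V hV => E.lift (hip m) (hE.van_isGor hV (hG (m + 1)) 0))
      (fun m V hV => E.desc (hip m) (hE.isGor_van hV (hG m) 0)),
    .ofSES Z U j q hjq' hU,
    Resolution.ofSES_isProper Z U j q hjq' hU
      (fun m V hV => E.lift (hjq' m) ((hS (m + 1)).van hE hV 0)),
    α, fun a b => ?_, n, fun m hm => ?_⟩, hα⟩
  · by_cases hab : a = b + 1
    · subst hab
      have e₁ := Resolution.ofSES_d Z U j q hjq' hU b
      have e₂ := spliceInt_d (fun m => (f m).left) T i p hip b
      refine (congrArg (α (b + 1) ≫ ·) e₁).trans (Eq.trans ?_ (congrArg (· ≫ α b) e₂).symm)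
      have h₁ := hpα (b + 1)
      have h₂ := hiα b
      calc α (b + 1) ≫ q (b + 1) ≫ j b = (α (b + 1) ≫ q (b + 1)) ≫ j b :=
          (Category.assoc _ _ _).symm
        _ = (p ((b + 1 : ℕ) : ℤ) ≫ (f ((b + 1 : ℕ) : ℤ)).hom) ≫ j b :=
          congrArg (· ≫ j b) h₁.symm
        _ = p ((b + 1 : ℕ) : ℤ) ≫ (f ((b + 1 : ℕ) : ℤ)).hom ≫ j b := Category.assoc _ _ _
        _ = p ((b : ℤ) + 1) ≫ i b ≫ α b := congrArg (p ((b : ℤ) + 1) ≫ ·) h₂.symm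
        _ = (p ((b : ℤ) + 1) ≫ i b) ≫ α b := (Category.assoc _ _ _).symm
    · rw [HomologicalComplex.shape _ _ _ (by simpa using Ne.symm hab),
        HomologicalComplex.shape _ _ _ (by simp; omega)]
      exact comp_zero.trans zero_comp.symm
  · have hi (k : ℕ) (hk : n ≤ k) : IsIso (f k).hom := by
      have := (hf k).1.2 (by positivity)
      rw [show n - (k : ℤ).toNat = 0 by omega] at this
      exact this.2
    have h1 := hi m hm
    have h2 : IsIso (f ((m : ℤ) + 1)).hom := hi (m + 1) (by omega)
    let φ : ShortComplex.mk _ _ (hip m).zero ⟶ ShortComplex.mk _ _ (hjq m).zero :=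
      ⟨(f ((m : ℤ) + 1)).hom, α m, (f m).hom, (hiα m).symm, (hpα m).symm⟩
    exact ShortComplex.isIso₂_of_shortExact_of_isIso₁₃' φ (hip m).2 (hjq m).2 h2 h1

/-- The characterization of objects admitting a Tate resolution. -/
lemma tateResolution_tfae (hW : IsSubcategory W) (hE : E.Orth W) (M : A) :
    [AdmitsTateResolution W M, ∃ t : TateResolution W M, ∀ n, IsSplitEpi (t.α n),
      projDim (Gor W) M < ⊤, EventuallyGor W M].TFAE := by
  tfae_have 1 → 4 := fun ⟨t⟩ => t.eventuallyGor
  tfae_have 4 → 3 := fun ⟨_, h⟩ => h.projDim_lt_top hW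
  tfae_have 3 → 4 := eventuallyGor_of_projDim_lt_top hW hE
  tfae_have 4 → 2 := fun ⟨n, h⟩ => by
    obtain ⟨X, rfl, hX⟩ := h.exists_approx hW hE
    exact hX.exists_tateResolution hE
  tfae_have 2 → 1 := fun ⟨t, _⟩ => ⟨t⟩
  tfae_finish

end TateRes
end

section
variable {A : Type v} [Category.{w} A] [Abelian A]

/-! ### Coresolutions as resolutions in the opposite category -/

section Duality

variable {P : ObjectProperty A}

lemma acyclic_coaugment_iff (C : CochainComplex A ℕ) {N : A} (η : N ⟶ C.X 0)
    (w : η ≫ C.d 0 1 = 0) :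
    (C.augment η w).Acyclic ↔ Mono η ∧ (ShortComplex.mk η _ w).Exact ∧
      ∀ n, (ShortComplex.mk (C.d n (n + 1)) (C.d (n + 1) (n + 2)) (by simp)).Exact := by
  have e0 : (C.augment η w).ExactAt 0 ↔ Mono η := by
    rw [HomologicalComplex.exactAt_iff' _ 0 0 1 (by simp) (by simp),
      ShortComplex.exact_iff_mono _ ((C.augment η w).shape 0 0 (by simp))]
    rfl
  have e1 : (C.augment η w).ExactAt 1 ↔ (ShortComplex.mk η _ w).Exact :=
    HomologicalComplex.exactAt_iff' _ 0 1 2 (by simp) (by simp)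
  have e2 (n : ℕ) : (C.augment η w).ExactAt (n + 2) ↔
      (ShortComplex.mk (C.d n (n + 1)) (C.d (n + 1) (n + 2)) (by simp)).Exact :=
    HomologicalComplex.exactAt_iff' _ (n + 1) (n + 2) (n + 3) (by simp) (by simp)
  simp only [← e0, ← e1, ← e2]
  refine ⟨fun h => ⟨h 0, h 1, fun n => h _⟩, fun ⟨h0, h1, h2⟩ n => ?_⟩
  match n with
  | 0 => exact h0
  | 1 => exact h1
  | n + 2 => exact h2 n

lemma homToExact_coaugment_iff (C : CochainComplex A ℕ) {N : A} (η : N ⟶ C.X 0)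
    (w : η ≫ C.d 0 1 = 0) : HomToExact P (C.augment η w) ↔ ∀ U, P U →
      (∀ f : N ⟶ U, ∃ g, η ≫ g = f) ∧
      (∀ f : C.X 0 ⟶ U, η ≫ f = 0 → ∃ g : C.X 1 ⟶ U, C.d 0 1 ≫ g = f) ∧
      ∀ n, ∀ f : C.X (n + 1) ⟶ U, C.d n (n + 1) ≫ f = 0 →
        ∃ g : C.X (n + 2) ⟶ U, C.d (n + 1) (n + 2) ≫ g = f := by
  refine forall₂_congr fun U hU => ?_
  have e0 := exactAt_yoneda_iff (C.augment η w) U (i := 0) (j := 0) (k := 1) (by simp) (by simp)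
  have e0' : (∀ f : N ⟶ U, ∃ g, η ≫ g = f) ↔ _ := Iff.trans
    ⟨fun h f _ => h f, fun h f => h f (by
      rw [(C.augment η w).shape 0 0 (by simp)]; exact zero_comp)⟩ e0.symm
  have e1 := exactAt_yoneda_iff (C.augment η w) U (i := 0) (j := 1) (k := 2) (by simp) (by simp)
  have e2 (n : ℕ) := exactAt_yoneda_iff (C.augment η w) U (i := n + 1) (j := n + 2) (k := n + 3)
    (by simp) (by simp)
  rw [e0']
  refine ⟨fun h => ⟨h 0, e1.1 (h 1), fun n => (e2 n).1 (h _)⟩, fun ⟨h0, h1, h2⟩ n => ?_⟩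
  match n with
  | 0 => exact h0
  | 1 => exact e1.2 h1
  | n + 2 => exact (e2 n).2 (h2 n)

/-- A coresolution, viewed as a resolution in the opposite category. -/
@[simps cx]
def Coresolution.op {N : A} (Y : Coresolution P N) : Resolution P.op (.op N) where
  cx :=
    { X := fun n => .op (Y.cx.X n)
      d := fun i j => (Y.cx.d j i).op
      shape := fun i j h => by rw [Y.cx.shape _ _ h, op_zero]
      d_comp_d' := fun i j k _ _ => by rw [← op_comp, Y.cx.d_comp_d, op_zero] }
  ε := Y.η.op
  w := by rw [← op_comp, Y.w, op_zero]
  mem n := Y.mem n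
  exact := by
    obtain ⟨h0, h1, h2⟩ := (acyclic_coaugment_iff _ _ _).1 Y.exact
    exact (acyclic_augment_iff _ _ _).2 ⟨inferInstance, h1.op, fun n => (h2 n).op⟩

lemma Coresolution.IsProper.op {N : A} {Y : Coresolution P N} (h : Y.IsProper) :
    Y.op.IsProper := by
  refine (homFromExact_augment_iff _ _ _).2 fun U hU => ?_
  obtain ⟨h0, h1, h2⟩ := (homToExact_coaugment_iff _ _ _).1 h U.unop hU
  refine ⟨fun f => ?_, fun f hf => ?_, fun n f hf => ?_⟩
  · obtain ⟨g, hg⟩ := h0 f.unop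
    exact ⟨g.op, Quiver.Hom.unop_inj hg⟩
  · obtain ⟨g, hg⟩ := h1 f.unop (Quiver.Hom.op_inj hf)
    exact ⟨g.op, Quiver.Hom.unop_inj hg⟩
  · obtain ⟨g, hg⟩ := h2 n f.unop (Quiver.Hom.op_inj hf)
    exact ⟨g.op, Quiver.Hom.unop_inj hg⟩

/-- A resolution in the opposite category, viewed as a coresolution. -/
@[simps cx]
def Resolution.unop {N : A} (Y : Resolution P.op (.op N)) : Coresolution P N where
  cx :=
    { X := fun n => (Y.cx.X n).unop
      d := fun i j => (Y.cx.d j i).unop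
      shape := fun i j h => by rw [Y.cx.shape _ _ h, unop_zero]
      d_comp_d' := fun i j k _ _ => by rw [← unop_comp, Y.cx.d_comp_d, unop_zero] }
  η := Y.ε.unop
  w := by rw [← unop_comp, Y.w, unop_zero]
  mem n := Y.mem n
  exact := by
    obtain ⟨h0, h1, h2⟩ := (acyclic_augment_iff _ _ _).1 Y.exact
    exact (acyclic_coaugment_iff _ _ _).2 ⟨inferInstance, h1.unop, fun n => (h2 n).unop⟩

lemma Resolution.IsProper.unop {N : A} {Y : Resolution P.op (.op N)} (h : Y.IsProper) :
    Y.unop.IsProper := by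
  refine (homToExact_coaugment_iff _ _ _).2 fun U hU => ?_
  obtain ⟨h0, h1, h2⟩ := (homFromExact_augment_iff _ _ _).1 h (.op U) hU
  refine ⟨fun f => ?_, fun f hf => ?_, fun n f hf => ?_⟩
  · obtain ⟨g, hg⟩ := h0 f.op
    exact ⟨g.unop, Quiver.Hom.op_inj hg⟩
  · obtain ⟨g, hg⟩ := h1 f.op (Quiver.Hom.unop_inj hf)
    exact ⟨g.unop, Quiver.Hom.op_inj hg⟩
  · obtain ⟨g, hg⟩ := h2 n f.op (Quiver.Hom.unop_inj hf)
    exact ⟨g.unop, Quiver.Hom.op_inj hg⟩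

lemma injDim_lt_top_iff {N : A} : injDim P N < ⊤ ↔
    ∃ (Y : Coresolution P N) (n₀ : ℕ), ∀ n, n₀ < n → IsZero (Y.cx.X n) := by
  rw [injDim, iInf_lt_iff]
  refine exists_congr fun X => ⟨fun h => ?_, fun ⟨n₀, h⟩ => ?_⟩
  · obtain ⟨m, hm⟩ := ENat.ne_top_iff_exists.1 h.ne
    refine ⟨m, fun n hn => ?_⟩
    by_contra hz
    have := le_iSup₂ (f := fun (n : ℕ) (_ : ¬ IsZero (X.cx.X n)) => (n : ℕ∞)) n hz
    rw [← hm] at this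
    exact absurd (Nat.cast_le.1 this) (by omega)
  · refine lt_of_le_of_lt (iSup₂_le fun n hn => ?_) (ENat.natCast_lt_top n₀)
    exact Nat.cast_le.2 (by by_contra hc; exact hn (h n (by omega)))

lemma injDim_lt_top_iff_op {N : A} : injDim P N < ⊤ ↔ projDim P.op (.op N) < ⊤ := by
  rw [injDim_lt_top_iff, projDim_lt_top_iff]
  exact ⟨fun ⟨Y, n₀, h⟩ => ⟨Y.op, n₀, fun n hn => (h n hn).op⟩,
    fun ⟨Y, n₀, h⟩ => ⟨Y.unop, n₀, fun n hn => (h n hn).unop⟩⟩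

lemma gor_op : Gor P.op = (Gor P).op := by
  rw [gor_eq_isGor, gor_eq_isGor, isGor_op]

/-- The complex in the opposite category with term `Tₙ` in degree `-n`. -/
@[simps]
def opInt (T : ChainComplex A ℤ) : ChainComplex Aᵒᵖ ℤ where
  X n := .op (T.X (-n))
  d i j := (T.d (-j) (-i)).op
  shape i j h := by
    rw [T.shape _ _ (by simp only [ComplexShape.down_Rel] at h ⊢; omega), op_zero]
  d_comp_d' i j k _ _ := by rw [← op_comp, T.d_comp_d, op_zero]

/-- The inverse construction to `opInt`. -/
@[simps]
def unopInt (T : ChainComplex Aᵒᵖ ℤ) : ChainComplex A ℤ where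
  X n := (T.X (-n)).unop
  d i j := (T.d (-j) (-i)).unop
  shape i j h := by
    rw [T.shape _ _ (by simp only [ComplexShape.down_Rel] at h ⊢; omega), unop_zero]
  d_comp_d' i j k _ _ := by rw [← unop_comp, T.d_comp_d, unop_zero]

lemma TotallyAcyclic.opInt {T : ChainComplex A ℤ} (h : TotallyAcyclic P T) :
    TotallyAcyclic P.op (opInt T) where
  mem n := h.mem (-n)
  exact j := by
    rw [HomologicalComplex.exactAt_iff' _ (j + 1) j (j - 1) (by simp) (by simp)]
    exact ((HomologicalComplex.exactAt_iff' _ (-(j - 1)) (-j) (-(j + 1)) (by simp; ring)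
      (by simp; ring)).1 (h.exact (-j))).op
  homFrom U hU j := by
    rw [exactAt_coyoneda_iff _ U (i := j + 1) (k := j - 1) (by simp) (by simp)]
    intro f hf
    obtain ⟨g, hg⟩ := (exactAt_yoneda_iff T U.unop (i := -(j - 1)) (j := -j) (k := -(j + 1))
      (by simp; ring) (by simp; ring)).1 (h.homTo U.unop hU _) f.unop (Quiver.Hom.op_inj hf)
    exact ⟨g.op, Quiver.Hom.unop_inj hg⟩
  homTo U hU j := by
    rw [exactAt_yoneda_iff _ U (i := j + 1) (k := j - 1) (by simp) (by simp)]
    intro f hf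
    obtain ⟨g, hg⟩ := (exactAt_coyoneda_iff T U.unop (i := -(j - 1)) (j := -j) (k := -(j + 1))
      (by simp; ring) (by simp; ring)).1 (h.homFrom U.unop hU _) f.unop (Quiver.Hom.op_inj hf)
    exact ⟨g.op, Quiver.Hom.unop_inj hg⟩

lemma TotallyAcyclic.unopInt {T : ChainComplex Aᵒᵖ ℤ} (h : TotallyAcyclic P.op T) :
    TotallyAcyclic P (unopInt T) where
  mem n := h.mem (-n)
  exact j := by
    rw [HomologicalComplex.exactAt_iff' _ (j + 1) j (j - 1) (by simp) (by simp)]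
    exact ((HomologicalComplex.exactAt_iff' _ (-(j - 1)) (-j) (-(j + 1)) (by simp; ring)
      (by simp; ring)).1 (h.exact (-j))).unop
  homFrom U hU j := by
    rw [exactAt_coyoneda_iff _ U (i := j + 1) (k := j - 1) (by simp) (by simp)]
    intro f hf
    obtain ⟨g, hg⟩ := (exactAt_yoneda_iff T (.op U) (i := -(j - 1)) (j := -j) (k := -(j + 1))
      (by simp; ring) (by simp; ring)).1 (h.homTo (.op U) hU _) f.op (Quiver.Hom.unop_inj hf)
    exact ⟨g.unop, Quiver.Hom.op_inj hg⟩
  homTo U hU j := by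
    rw [exactAt_yoneda_iff _ U (i := j + 1) (k := j - 1) (by simp) (by simp)]
    intro f hf
    obtain ⟨g, hg⟩ := (exactAt_coyoneda_iff T (.op U) (i := -(j - 1)) (j := -j) (k := -(j + 1))
      (by simp; ring) (by simp; ring)).1 (h.homFrom (.op U) hU _) f.op (Quiver.Hom.unop_inj hf)
    exact ⟨g.unop, Quiver.Hom.op_inj hg⟩

/-- A Tate coresolution, viewed as a Tate resolution in the opposite category. -/
def TateCoresolution.op {N : A} (t : TateCoresolution P N) : TateResolution P.op (.op N) where
  T := opInt t.S
  totallyAcyclic := t.totallyAcyclic.opInt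
  W := t.V.op
  proper := t.proper.op
  α n := (t.β n).op
  comm i j := Quiver.Hom.unop_inj (t.comm j i).symm
  eventually_iso := by
    obtain ⟨n₀, h⟩ := t.eventually_iso
    exact ⟨n₀, fun n hn => by have := h n hn; exact isIso_op (t.β n)⟩

/-- A Tate resolution in the opposite category, viewed as a Tate coresolution. -/
def TateResolution.unop {N : A} (t : TateResolution P.op (.op N)) : TateCoresolution P N where
  S := unopInt t.T
  totallyAcyclic := t.totallyAcyclic.unopInt
  V := t.W.unop
  proper := t.proper.unop
  β n := ((t.T.XIsoOfEq (neg_neg (n : ℤ))).hom ≫ t.α n).unop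
  comm i j := by
    apply Quiver.Hom.op_inj
    change t.T.d (- -(j : ℤ)) (- -(i : ℤ)) ≫ (t.T.XIsoOfEq (neg_neg (i : ℤ))).hom ≫ t.α i =
      ((t.T.XIsoOfEq (neg_neg (j : ℤ))).hom ≫ t.α j) ≫ t.W.cx.d j i
    simp [t.comm]
  eventually_iso := by
    obtain ⟨n₀, h⟩ := t.eventually_iso
    exact ⟨n₀, fun n hn => by
      have := h n hn
      exact isIso_unop ((t.T.XIsoOfEq (neg_neg (n : ℤ))).hom ≫ t.α n)⟩

lemma TateResolution.isSplitMono_unop_β {N : A} (t : TateResolution P.op (.op N)) (n : ℕ)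
    [h : IsSplitEpi (t.α n)] : IsSplitMono (t.unop.β n) := by
  refine ⟨⟨⟨(section_ (t.α n) ≫ (t.T.XIsoOfEq (neg_neg (n : ℤ))).inv).unop, ?_⟩⟩⟩
  apply Quiver.Hom.op_inj
  change (section_ (t.α n) ≫ (t.T.XIsoOfEq (neg_neg (n : ℤ))).inv) ≫
    ((t.T.XIsoOfEq (neg_neg (n : ℤ))).hom ≫ t.α n) = 𝟙 _
  simp

/-- The dual characterization, obtained from `tateResolution_tfae` in the opposite category. -/
lemma tateCoresolution_tfae {E : ExtVan A} (hW : IsSubcategory P) (hE : E.Orth P) (N : A) :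
    [AdmitsTateCoresolution P N, ∃ t : TateCoresolution P N, ∀ n, IsSplitMono (t.β n),
      injDim (Gor P) N < ⊤, EventuallyGor P.op (.op N)].TFAE := by
  have h := tateResolution_tfae hW.op hE.op (.op N)
  tfae_have 1 → 4 := fun ⟨t⟩ => t.op.eventuallyGor
  tfae_have 4 → 2 := fun H => by
    obtain ⟨t, ht⟩ := (h.out 3 1).1 H
    exact ⟨t.unop, fun n => by have := ht n; exact t.isSplitMono_unop_β n⟩
  tfae_have 2 → 1 := fun ⟨t, _⟩ => ⟨t⟩
  tfae_have 3 ↔ 4 := by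
    rw [injDim_lt_top_iff_op, ← gor_op]
    exact h.out 2 3
  tfae_finish

lemma TwoOfThree.of_op {Q : ObjectProperty Aᵒᵖ} (h : TwoOfThree Q) :
    TwoOfThree fun X : A => Q (.op X) where
  extensions S hS h₁ h₃ := h.extensions S.op hS.op h₃ h₁
  kernels S hS h₂ h₃ := h.cokernels S.op hS.op h₃ h₂
  cokernels S hS h₁ h₂ := h.kernels S.op hS.op h₂ h₁

lemma coEventuallyGor_summands {E : ExtVan A} (hW : IsSubcategory P) (hE : E.Orth P) :
    ClosedUnderSummands fun X : A => EventuallyGor P.op (.op X) := by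
  rintro M N ⟨n, h⟩
  obtain ⟨e⟩ := nonempty_op_biprod_iso M N
  exact ⟨n, .summand hW.op hE.op (h.of_iso e)⟩

end Duality

/-! ### Tate resolutions in abelian categories -/

section Main

lemma extVan_orth [HasExt.{x} A] {W : ObjectProperty A} (h : Perp.{v, w, x} W W) :
    (extVan.{v, w, x} A).Orth W :=
  fun n _ _ hX hY => h _ _ hX hY (n + 1) (Nat.le_add_left 1 n)

theorem tateResolution_abelian [HasExt.{x} A] (W : ObjectProperty A)
    (hW : IsSubcategory W) (hK : ClosedUnderKernelsOfEpis W) (hE : Perp.{v, w, x} W W) :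
    (∀ M : A, AdmitsTateResolution W M ↔ projDim (Gor W) M < ⊤) ∧
    (∀ M : A, (∃ t : TateResolution W M, ∀ n : ℕ, IsSplitEpi (t.α n)) ↔
      projDim (Gor W) M < ⊤) ∧
    ClosedUnderSummands (AdmitsTateResolution W) ∧ TwoOfThree (AdmitsTateResolution W) := by
  have hE := extVan_orth hE
  have e : AdmitsTateResolution W = EventuallyGor W := by
    ext M
    exact (tateResolution_tfae hW hE M).out 0 3
  refine ⟨fun M => (tateResolution_tfae hW hE M).out 0 2,
    fun M => (tateResolution_tfae hW hE M).out 1 2, ?_, ?_⟩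
  · rw [e]
    exact EventuallyGor.summands hW hE
  · rw [e]
    exact EventuallyGor.twoOfThree hW hE hK

theorem tateCoresolution_abelian [HasExt.{x} A] (V : ObjectProperty A)
    (hV : IsSubcategory V) (hC : ClosedUnderCokernelsOfMonos V) (hE : Perp.{v, w, x} V V) :
    (∀ N : A, AdmitsTateCoresolution V N ↔ injDim (Gor V) N < ⊤) ∧
    (∀ N : A, (∃ t : TateCoresolution V N, ∀ n : ℕ, IsSplitMono (t.β n)) ↔
      injDim (Gor V) N < ⊤) ∧
    ClosedUnderSummands (AdmitsTateCoresolution V) ∧ TwoOfThree (AdmitsTateCoresolution V) := by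
  have hE := extVan_orth hE
  have e : AdmitsTateCoresolution V = fun N => EventuallyGor V.op (.op N) := by
    ext N
    exact (tateCoresolution_tfae hV hE N).out 0 3
  refine ⟨fun M => (tateCoresolution_tfae hV hE M).out 0 2,
    fun M => (tateCoresolution_tfae hV hE M).out 1 2, ?_, ?_⟩
  · rw [e]
    exact coEventuallyGor_summands hV hE
  · rw [e]
    exact (EventuallyGor.twoOfThree hV.op hE.op
      fun S hS h₂ h₃ => hC S.unop hS.unop h₃ h₂).of_op

end Main
end

/-! ### Faithful finitely generated modules -/

section Linear

open TensorProduct Matrix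

variable {R : Type u} [CommRing R]

/-- Let `C` be generated by `c₁, …, cₙ` and let `d ∈ D`. The determinant vanishes on tuples of
relations between the `cᵢ` because it annihilates `C`. If `d • det(k₁, …, kₘ, v, …)` vanishes for
all relations `kᵢ` and all vectors `v`, then as a function of `kₘ` it factors through `C`, hence
vanishes for all vectors `kₘ`; so `d • det` vanishes identically. -/
lemma subsingleton_of_hom_eq_zero {C D : Type*} [AddCommGroup C] [Module R C] [Module.Finite R C]
    [AddCommGroup D] [Module R D] (hC : ∀ r : R, (∀ c : C, r • c = 0) → r = 0)
    (h : ∀ f : C →ₗ[R] D, f = 0) : Subsingleton D := by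
  refine subsingleton_of_forall_eq 0 fun d => ?_
  obtain ⟨n, π, hπ⟩ := Module.Finite.exists_fin' R C
  have key : ∀ m : ℕ, m ≤ n → ∀ v : Fin n → (Fin n → R),
      (∀ i : Fin n, (i : ℕ) < n - m → π (v i) = 0) → (Matrix.of v).det • d = 0 := by
    intro m
    induction m with
    | zero =>
      intro _ v hv
      rw [hC (Matrix.of v).det fun c => ?_, zero_smul]
      obtain ⟨x, rfl⟩ := hπ c
      have hx : (Matrix.of v).det • x = (x ᵥ* (Matrix.of v).adjugate) ᵥ* Matrix.of v := by
        rw [Matrix.vecMul_vecMul, Matrix.adjugate_mul, Matrix.vecMul_smul, Matrix.vecMul_one]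
      rw [← map_smul, hx, Matrix.vecMul_eq_sum, map_sum]
      refine Finset.sum_eq_zero fun i _ => ?_
      rw [map_smul]
      have : π (v i) = 0 := hv i (by simp)
      change _ • π (v i) = 0
      rw [this, smul_zero]
    | succ m ih =>
      intro hm v hv
      let k : Fin n := ⟨n - (m + 1), by omega⟩
      let φ : (Fin n → R) →ₗ[R] D :=
        (LinearMap.toSpanSingleton R D d) ∘ₗ
          ((Matrix.detRowAlternating (n := Fin n) (R := R)).toMultilinearMap.toLinearMap v k)
      have hφ (w : Fin n → R) : φ w = (Matrix.of (Function.update v k w)).det • d := rfl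
      have hker : LinearMap.ker π ≤ LinearMap.ker φ := by
        intro w hw
        rw [LinearMap.mem_ker, hφ]
        refine ih (by omega) _ fun i hi => ?_
        by_cases hik : i = k
        · subst hik
          simpa using hw
        · rw [Function.update_of_ne hik]
          refine hv i ?_
          have : (i : ℕ) ≠ n - (m + 1) := fun h => hik (Fin.ext h)
          omega
      have h0 := h (((LinearMap.ker π).liftQ φ hker) ∘ₗ (π.quotKerEquivOfSurjective hπ).symm)
      have h1 := LinearMap.congr_fun h0 (π (v k))
      have h2 : (π.quotKerEquivOfSurjective hπ).symm (π (v k)) = Submodule.Quotient.mk (v k) := by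
        rw [LinearEquiv.symm_apply_eq]; rfl
      rw [LinearMap.comp_apply, LinearEquiv.coe_coe, h2] at h1
      have h3 : φ (v k) = 0 := h1
      rwa [hφ, Function.update_eq_self] at h3
  have h1 : (1 : Matrix (Fin n) (Fin n) R).det • d = 0 :=
    key n le_rfl (1 : Matrix (Fin n) (Fin n) R) (fun i hi => by omega)
  simpa using h1

/-- Tensoring with a faithful finitely generated module is faithful on objects. -/
lemma subsingleton_of_tensor {C Z : Type*} [AddCommGroup C] [Module R C] [Module.Finite R C]
    [AddCommGroup Z] [Module R Z] (hC : ∀ r : R, (∀ c : C, r • c = 0) → r = 0)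
    (h : Subsingleton (Z ⊗[R] C)) : Subsingleton Z := by
  have : Subsingleton (Z →ₗ[R] Z) := subsingleton_of_hom_eq_zero hC fun f => by
    ext c z
    have : z ⊗ₜ[R] c = 0 := Subsingleton.elim _ _
    simpa using congrArg (TensorProduct.lift f.flip) this
  exact subsingleton_of_forall_eq 0 fun z => by
    simpa using LinearMap.congr_fun (Subsingleton.elim (LinearMap.id : Z →ₗ[R] Z) 0) z

/-! ### Injective modules and evaluation maps -/

lemma injective_of_retract {M M' : Type u} [AddCommGroup M] [Module R M] [AddCommGroup M']
    [Module R M'] (i : M' →ₗ[R] M) (r : M →ₗ[R] M') (h : ∀ x, r (i x) = x) [Module.Injective R M] :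
    Module.Injective R M' where
  out _ _ _ _ _ _ f hf g := by
    obtain ⟨L, hL⟩ := Module.Injective.out f hf (i ∘ₗ g)
    exact ⟨r ∘ₗ L, fun x => by simp [hL, h]⟩

/-- A linear map to an injective module that vanishes on the kernel of `φ` factors through `φ`. -/
lemma exists_factor_of_ker_le {X Y I : Type u} [AddCommGroup X] [Module R X] [AddCommGroup Y]
    [Module R Y] [AddCommGroup I] [Module R I] [Module.Injective R I] (φ : X →ₗ[R] Y)
    (ψ : X →ₗ[R] I) (h : LinearMap.ker φ ≤ LinearMap.ker ψ) : ∃ L : Y →ₗ[R] I, L ∘ₗ φ = ψ := by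
  obtain ⟨L, hL⟩ := Module.Injective.out ((LinearMap.ker φ).liftQ φ le_rfl)
    (LinearMap.ker_eq_bot.1 (Submodule.ker_liftQ_eq_bot _ _ _ le_rfl))
    ((LinearMap.ker φ).liftQ ψ h)
  exact ⟨L, LinearMap.ext fun x => hL (Submodule.Quotient.mk x)⟩

variable (R) in
/-- The evaluation `Hom(B, I) ⊗ D ⟶ Hom(Hom(D, B), I)`, `f ⊗ d ↦ (g ↦ f (g d))`. -/
noncomputable def tensorEval (B D I : Type*) [AddCommGroup B] [Module R B] [AddCommGroup D]
    [Module R D] [AddCommGroup I] [Module R I] :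
    (B →ₗ[R] I) ⊗[R] D →ₗ[R] ((D →ₗ[R] B) →ₗ[R] I) :=
  TensorProduct.lift (LinearMap.mk₂ R (fun f d => f ∘ₗ LinearMap.applyₗ d)
    (fun _ _ _ => by ext; simp) (fun _ _ _ => by ext; simp) (fun _ _ _ => by ext; simp)
    (fun _ _ _ => by ext; simp))

section

variable {B D I : Type*} [AddCommGroup B] [Module R B] [AddCommGroup D]
    [Module R D] [AddCommGroup I] [Module R I]

@[simp] lemma tensorEval_tmul (f : B →ₗ[R] I) (d : D) (g : D →ₗ[R] B) :
    tensorEval R B D I (f ⊗ₜ d) g = f (g d) := rfl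

lemma tensorEval_lTensor {D' : Type*} [AddCommGroup D'] [Module R D'] (a : D' →ₗ[R] D)
    (t : (B →ₗ[R] I) ⊗[R] D') (g : D →ₗ[R] B) :
    tensorEval R B D I (a.lTensor _ t) g = tensorEval R B D' I t (g ∘ₗ a) := by
  induction t with
  | zero => simp
  | tmul f d => simp
  | add x y hx hy => simp [hx, hy]

lemma tensorEval_bijective_of_basis {ι : Type*} [Fintype ι] (b : Module.Basis ι R D) :
    Function.Bijective (tensorEval R B D I) := by
  let ψ : ((D →ₗ[R] B) →ₗ[R] I) →ₗ[R] (B →ₗ[R] I) ⊗[R] D :=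
    ∑ i, ((TensorProduct.mk R (B →ₗ[R] I) D).flip (b i)) ∘ₗ
      (LinearMap.lcomp R I (LinearMap.smulRightₗ (b.coord i)))
  have hψ (L) : ψ L = ∑ i, (L ∘ₗ (LinearMap.smulRightₗ (b.coord i))) ⊗ₜ b i := by
    simp [ψ, LinearMap.sum_apply]
    rfl
  refine Function.bijective_iff_has_inverse.2 ⟨ψ, fun t => ?_, fun L => ?_⟩
  · induction t with
    | zero => simp
    | add x y hx hy => rw [map_add, map_add, hx, hy]
    | tmul f d =>
      rw [hψ]
      conv_rhs => rw [← b.sum_repr d, TensorProduct.tmul_sum]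
      refine Finset.sum_congr rfl fun i _ => ?_
      rw [TensorProduct.tmul_smul, TensorProduct.smul_tmul']
      congr 1
      ext x
      simp
  · ext g
    rw [hψ, map_sum, LinearMap.sum_apply]
    simp only [tensorEval_tmul, LinearMap.comp_apply]
    rw [← map_sum]
    congr 1
    refine b.ext fun j => ?_
    classical
    simp [LinearMap.sum_apply, Finsupp.single_apply, ite_smul]

end

/-- The evaluation map is bijective if `D` is finitely presented and `I` is injective: both sides
are right exact functors of `D`. -/
lemma tensorEval_bijective {B D I : Type u} [AddCommGroup B] [Module R B] [AddCommGroup D]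
    [Module R D] [AddCommGroup I] [Module R I] [Module.FinitePresentation R D]
    [Module.Injective R I] : Function.Bijective (tensorEval R B D I) := by
  obtain ⟨n, m, q, a, hq, haq⟩ := Module.FinitePresentation.exists_fin' R D
  have hqa : q ∘ₗ a = 0 := haq.linearMap_comp_eq_zero
  have h₁ := tensorEval_bijective_of_basis (B := B) (I := I) (Pi.basisFun R (Fin m))
  have h₀ := tensorEval_bijective_of_basis (B := B) (I := I) (Pi.basisFun R (Fin n))
  refine ⟨(injective_iff_map_eq_zero _).2 fun x hx => ?_, fun L => ?_⟩
  · -- lift `x` to `t`; the image of `t` factors through `Hom(a, B)`, hence comes from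
    -- `Hom(B, I) ⊗ Rᵐ`
    obtain ⟨t, rfl⟩ := LinearMap.lTensor_surjective (B →ₗ[R] I) hq x
    obtain ⟨L, hL⟩ := exists_factor_of_ker_le (LinearMap.lcomp R B a)
      (tensorEval R B (Fin n → R) I t) fun g hg => by
        have hga : g ∘ₗ a = 0 := hg
        have hker : LinearMap.ker q ≤ LinearMap.ker g := fun y hy => by
          obtain ⟨z, rfl⟩ := (haq y).1 hy
          exact LinearMap.congr_fun hga z
        have e : ((LinearMap.ker q).liftQ g hker ∘ₗ (q.quotKerEquivOfSurjective hq).symm) ∘ₗ q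
            = g := by
          ext i
          have h2 (y) : (q.quotKerEquivOfSurjective hq).symm (q y) = Submodule.Quotient.mk y := by
            rw [LinearEquiv.symm_apply_eq]; rfl
          simp only [LinearMap.comp_apply, LinearEquiv.coe_coe, h2]
          rfl
        rw [LinearMap.mem_ker, ← e, ← tensorEval_lTensor, hx, LinearMap.zero_apply]
    obtain ⟨s, rfl⟩ := h₁.2 L
    have : a.lTensor _ s = t := h₀.1 (by
      ext g : 1
      rw [tensorEval_lTensor, ← hL]
      rfl)
    rw [← this, ← LinearMap.comp_apply, ← LinearMap.lTensor_comp, hqa]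
    simp
  · obtain ⟨L₀, hL₀⟩ := exists_factor_of_ker_le (LinearMap.lcomp R B q) L fun g hg => by
      have : g = 0 := by
        ext x
        obtain ⟨y, rfl⟩ := hq x
        exact LinearMap.congr_fun (show g ∘ₗ q = 0 from hg) y
      simp [this]
    obtain ⟨t, ht⟩ := h₀.2 L₀
    refine ⟨q.lTensor _ t, ?_⟩
    ext g
    rw [tensorEval_lTensor, ht, ← hL₀]
    rfl

end Linear

/-! ### Modules reconstructed from the adjunction between tensor product and `Hom` -/

section Classes

open TensorProduct

variable {R : Type u} [CommRing R] (C : Type u) [AddCommGroup C] [Module R C]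

variable (R) in
/-- The counit `Hom(C, M) ⊗ C ⟶ M`. -/
noncomputable def evalMap (M : Type u) [AddCommGroup M] [Module R M] :
    (C →ₗ[R] M) ⊗[R] C →ₗ[R] M :=
  TensorProduct.lift LinearMap.id

@[simp] lemma evalMap_tmul {M : Type u} [AddCommGroup M] [Module R M] (f : C →ₗ[R] M) (c : C) :
    evalMap R C M (f ⊗ₜ c) = f c := rfl

variable (R) in
/-- The unit `M ⟶ Hom(C, M ⊗ C)`. -/
noncomputable abbrev coevalMap (M : Type u) [AddCommGroup M] [Module R M] :
    M →ₗ[R] (C →ₗ[R] M ⊗[R] C) := TensorProduct.mk R M C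

variable {C}
variable {M N : Type u} [AddCommGroup M] [Module R M] [AddCommGroup N] [Module R N]

lemma evalMap_naturality (f : M →ₗ[R] N) (t : (C →ₗ[R] M) ⊗[R] C) :
    evalMap R C N (LinearMap.rTensor C (LinearMap.compRight R f) t) = f (evalMap R C M t) := by
  induction t with
  | zero => simp
  | tmul g c => simp
  | add x y hx hy => simp [hx, hy]

/-- Bijectivity passes to retracts. -/
lemma bijective_of_retract {X Y X' Y' : Type*} {f : X → Y} {f' : X' → Y'}
    (hf : Function.Bijective f) {i : X' → X} {r : X → X'} {j : Y' → Y} {s : Y → Y'}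
    (hr : ∀ x, r (i x) = x)
    (hs : ∀ y, s (j y) = y) (h₁ : ∀ x, f (i x) = j (f' x)) (h₂ : ∀ x, f' (r x) = s (f x)) :
    Function.Bijective f' := by
  refine ⟨fun x y hxy => ?_, fun y => ?_⟩
  · have : i x = i y := hf.1 (by rw [h₁, h₁, hxy])
    rw [← hr x, this, hr]
  · obtain ⟨x, hx⟩ := hf.2 (j y)
    exact ⟨r x, by rw [h₂, hx, hs]⟩

variable (R C M) in
/-- `Hom(C, M)` is projective and `M` is recovered from it by tensoring with `C`. -/
def IsCProj : Prop := Module.Projective R (C →ₗ[R] M) ∧ Function.Bijective (evalMap R C M)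

variable (R C M) in
/-- `M ⊗ C` is injective and `M` is recovered from it by applying `Hom(C, -)`. -/
def IsCInj : Prop := Module.Injective R (M ⊗[R] C) ∧ Function.Bijective (coevalMap R C M)

lemma IsCProj.of_retract (h : IsCProj R C M) (i : N →ₗ[R] M) (r : M →ₗ[R] N)
    (hr : ∀ x, r (i x) = x) : IsCProj R C N := by
  obtain ⟨h₁, h₂⟩ := h
  refine ⟨Module.Projective.of_split (LinearMap.compRight R i) (LinearMap.compRight R r) ?_,
    bijective_of_retract h₂ (i := LinearMap.rTensor C (LinearMap.compRight R i))
      (r := LinearMap.rTensor C (LinearMap.compRight R r)) (j := i) (s := r) ?_ hr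
      (evalMap_naturality i) (evalMap_naturality r)⟩
  · ext f c
    simp [hr]
  · intro t
    rw [← LinearMap.comp_apply, ← LinearMap.rTensor_comp]
    have : LinearMap.compRight R r ∘ₗ LinearMap.compRight (M := C) R i = LinearMap.id := by
      ext f c
      simp [hr]
    rw [this]
    simp

lemma IsCInj.of_retract (h : IsCInj R C M) (i : N →ₗ[R] M) (r : M →ₗ[R] N)
    (hr : ∀ x, r (i x) = x) : IsCInj R C N := by
  have hri : r ∘ₗ i = LinearMap.id := LinearMap.ext hr
  obtain ⟨h₁, h₂⟩ := h
  have hT (t) : r.rTensor C (i.rTensor C t) = t := by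
    rw [← LinearMap.comp_apply, ← LinearMap.rTensor_comp, hri]
    simp
  refine ⟨injective_of_retract _ _ hT,
    bijective_of_retract h₂ (i := i) (r := r) (j := LinearMap.compRight R (i.rTensor C))
      (s := LinearMap.compRight R (r.rTensor C)) hr ?_ (fun _ => rfl) (fun _ => rfl)⟩
  intro f
  ext c
  exact hT _

/-- Over a module with bijective homothety map the unit is bijective at free modules. -/
lemma coevalMap_finsupp_bijective [Module.Finite R C]
    (hC : Function.Bijective (LinearMap.lsmul R C)) (X : Type u) :
    Function.Bijective (coevalMap R C (X →₀ R)) := by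
  classical
  let e : (X →₀ R) ⊗[R] C ≃ₗ[R] (X →₀ C) := TensorProduct.finsuppScalarLeft R C X
  have he (a : X →₀ R) (c : C) (x : X) : e (a ⊗ₜ c) x = a x • c := by
    simp [e]
  refine ⟨(injective_iff_map_eq_zero _).2 fun a ha => ?_, fun φ => ?_⟩
  · ext x
    refine hC.1 ?_
    ext c
    have := congrArg e (LinearMap.congr_fun ha c)
    have := DFunLike.congr_fun this x
    rw [TensorProduct.mk_apply, he] at this
    simpa using this
  · obtain ⟨s, hs⟩ := Module.Finite.fg_top (R := R) (M := C)
    have hcoord (x : X) : ∃ r : R, ∀ c, e (φ c) x = r • c := by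
      obtain ⟨r, hr⟩ := hC.2 (Finsupp.lapply x ∘ₗ e.toLinearMap ∘ₗ φ)
      exact ⟨r, fun c => (LinearMap.congr_fun hr c).symm⟩
    choose r hr using hcoord
    have hfin : ∀ x, r x ≠ 0 → x ∈ s.biUnion fun c => (e (φ c)).support := by
      intro x hx
      by_contra hmem
      apply hx
      refine hC.1 ?_
      have : Finsupp.lapply x ∘ₗ e.toLinearMap ∘ₗ φ = 0 := by
        refine LinearMap.ext_on hs fun c hc => ?_
        by_contra hne
        exact hmem (Finset.mem_biUnion.2 ⟨c, hc, Finsupp.mem_support_iff.2 hne⟩)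
      ext c
      have := LinearMap.congr_fun this c
      simpa [hr] using this
    refine ⟨Finsupp.onFinset _ r hfin, ?_⟩
    ext c
    apply e.injective
    ext x
    rw [TensorProduct.mk_apply, he, hr]
    rfl

/-- By passage to a direct summand of a free module. -/
lemma coevalMap_bijective [Module.Finite R C] (hC : Function.Bijective (LinearMap.lsmul R C))
    (P : Type u) [AddCommGroup P] [Module R P] [Module.Projective R P] :
    Function.Bijective (coevalMap R C P) := by
  obtain ⟨i, hi⟩ := Module.projective_def'.1 ‹Module.Projective R P›
  have hi' (x : P) : Finsupp.linearCombination R id (i x) = x := LinearMap.congr_fun hi x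
  refine bijective_of_retract (coevalMap_finsupp_bijective hC P) (i := i)
    (r := Finsupp.linearCombination R id) (j := LinearMap.compRight R (i.rTensor C))
    (s := LinearMap.compRight R (LinearMap.rTensor C (Finsupp.linearCombination R id))) hi' ?_
    (fun _ => rfl) (fun _ => rfl)
  intro f
  ext c
  change LinearMap.rTensor C _ (LinearMap.rTensor C i (f c)) = f c
  rw [← LinearMap.comp_apply, ← LinearMap.rTensor_comp, hi]
  simp

/-- Under the homothety isomorphism the counit is `tensorEval` with `B = D = C`. -/
lemma evalMap_bijective [Module.FinitePresentation R C]
    (hC : Function.Bijective (LinearMap.lsmul R C)) (I : Type u)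
    [AddCommGroup I] [Module R I] [Module.Injective R I] : Function.Bijective (evalMap R C I) := by
  let e : R ≃ₗ[R] (C →ₗ[R] C) := LinearEquiv.ofBijective _ hC
  let e' : ((C →ₗ[R] C) →ₗ[R] I) ≃ₗ[R] I :=
    (LinearEquiv.congrLeft I R e.symm).trans (LinearMap.ringLmapEquivSelf R R I)
  have h : ⇑(evalMap R C I) = e' ∘ tensorEval R C C I := by
    ext t
    induction t with
    | zero => simp
    | tmul f c =>
      change f c = f ((LinearMap.lsmul R C 1) c)
      simp
    | add x y hx hy => simp only [map_add, hx, hy, Function.comp_apply]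
  rw [h]
  exact e'.bijective.comp tensorEval_bijective

lemma isCProj_tensor [Module.Finite R C] (hC : Function.Bijective (LinearMap.lsmul R C))
    (P : Type u) [AddCommGroup P] [Module R P] [Module.Projective R P] :
    IsCProj R C (P ⊗[R] C) := by
  have hb := coevalMap_bijective hC P
  let e := LinearEquiv.ofBijective _ hb
  refine ⟨.of_equiv e, ?_⟩
  let e' := LinearEquiv.rTensor C e
  have h : ⇑(evalMap R C (P ⊗[R] C)) ∘ e' = id := by
    ext t
    induction t with
    | zero => simp
    | tmul p c => rfl
    | add x y hx hy =>
      simp only [Function.comp_apply, id] at hx hy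
      simp only [Function.comp_apply, map_add, hx, hy, id]
  refine (Function.Bijective.of_comp_iff _ e'.bijective).1 ?_
  rw [h]
  exact Function.bijective_id

lemma isCInj_hom [Module.FinitePresentation R C] (hC : Function.Bijective (LinearMap.lsmul R C))
    (I : Type u) [AddCommGroup I] [Module R I] [Module.Injective R I] :
    IsCInj R C (C →ₗ[R] I) := by
  let e := LinearEquiv.ofBijective _ (evalMap_bijective hC I)
  refine ⟨injective_of_retract e.toLinearMap e.symm.toLinearMap (fun x => by simp), ?_⟩
  let e' := LinearEquiv.congrRight (M := C) e
  have h : e' ∘ coevalMap R C (C →ₗ[R] I) = id := rfl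
  refine (Function.Bijective.of_comp_iff' e'.bijective _).1 ?_
  rw [h]
  exact Function.bijective_id

/-- Every surjection `f` between `C`-projective modules is split: `Hom(C, f)` becomes surjective
after tensoring with `C`, so its cokernel vanishes, and it is split because its target is
projective. -/
lemma IsCProj.exists_section [Module.Finite R C]
    (hC : ∀ r : R, (∀ c : C, r • c = 0) → r = 0)
    (hM : IsCProj R C M) (hN : IsCProj R C N) (f : M →ₗ[R] N) (hf : Function.Surjective f) :
    ∃ s : N →ₗ[R] M, f ∘ₗ s = LinearMap.id := by
  obtain ⟨-, hM⟩ := hM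
  obtain ⟨hP, hN⟩ := hN
  let φ := LinearMap.compRight (M := C) R f
  have h₁ : Function.Surjective (φ.rTensor C) := fun t => by
    obtain ⟨m, hm⟩ := hf (evalMap R C N t)
    obtain ⟨t', rfl⟩ := hM.2 m
    exact ⟨t', hN.1 (by rw [evalMap_naturality, hm])⟩
  have h₂ : Subsingleton (((C →ₗ[R] N) ⧸ LinearMap.range φ) ⊗[R] C) := by
    refine subsingleton_of_forall_eq 0 fun z => ?_
    obtain ⟨t, rfl⟩ := LinearMap.rTensor_surjective C (LinearMap.range φ).mkQ_surjective z
    obtain ⟨t', rfl⟩ := h₁ t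
    rw [← LinearMap.comp_apply, ← LinearMap.rTensor_comp, LinearMap.range_mkQ_comp]
    simp
  have h₃ := subsingleton_of_tensor hC h₂
  have h₄ : Function.Surjective φ :=
    LinearMap.range_eq_top.1 (Submodule.Quotient.subsingleton_iff.1 h₃)
  obtain ⟨s, hs⟩ := Module.projective_lifting_property φ LinearMap.id h₄
  let e := LinearEquiv.ofBijective _ hN
  refine ⟨evalMap R C M ∘ₗ s.rTensor C ∘ₗ e.symm.toLinearMap, ?_⟩
  ext n
  obtain ⟨t, rfl⟩ := e.surjective n
  simp only [LinearMap.comp_apply, LinearEquiv.coe_coe, LinearEquiv.symm_apply_apply]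
  rw [← evalMap_naturality, ← LinearMap.comp_apply (LinearMap.rTensor C _),
    ← LinearMap.rTensor_comp]
  change evalMap R C N (LinearMap.rTensor C (φ ∘ₗ s) t) = evalMap R C N t
  rw [hs]
  simp

/-- Every injection `f` between `C`-injective modules is split: as `Hom(C, f ⊗ C)` is injective,
there is no nonzero map from `C` to the kernel of `f ⊗ C`, so `f ⊗ C` is injective, and it is split
because its source is injective. -/
lemma IsCInj.exists_retraction [Module.Finite R C]
    (hC : ∀ r : R, (∀ c : C, r • c = 0) → r = 0)
    (hM : IsCInj R C M) (hN : IsCInj R C N) (f : M →ₗ[R] N) (hf : Function.Injective f) :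
    ∃ r : N →ₗ[R] M, r ∘ₗ f = LinearMap.id := by
  obtain ⟨hI, hM⟩ := hM
  obtain ⟨-, hN⟩ := hN
  have h₁ : Subsingleton (LinearMap.ker (f.rTensor C)) := by
    refine subsingleton_of_hom_eq_zero hC fun φ => ?_
    obtain ⟨m, hm⟩ := hM.2 ((LinearMap.ker (f.rTensor C)).subtype ∘ₗ φ)
    have hm' (c : C) : m ⊗ₜ[R] c = φ c := LinearMap.congr_fun hm c
    have h0 : m = 0 := by
      rw [← map_eq_zero_iff f hf, ← map_eq_zero_iff (coevalMap R C N) hN.1]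
      ext c
      have := (φ c).2
      rw [← hm', LinearMap.mem_ker, LinearMap.rTensor_tmul] at this
      exact this
    ext c
    rw [← hm', h0]
    simp
  have h₂ : Function.Injective (f.rTensor C) :=
    LinearMap.ker_eq_bot.1 (Submodule.subsingleton_iff_eq_bot.1 h₁)
  obtain ⟨ρ, hρ⟩ := Module.Injective.out (f.rTensor C) h₂ LinearMap.id
  let e := LinearEquiv.ofBijective _ hM
  refine ⟨e.symm.toLinearMap ∘ₗ LinearMap.compRight R ρ ∘ₗ coevalMap R C N, ?_⟩
  ext m
  simp only [LinearMap.comp_apply, LinearEquiv.coe_coe, LinearMap.id_apply]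
  rw [LinearEquiv.symm_apply_eq]
  ext c
  exact hρ (m ⊗ₜ c)

end Classes

/-! ### Orthogonality of the classes attached to a semidualizing module -/

section Retracts

variable {A : Type v} [Category.{w} A] [Abelian A] [HasExt.{x} A]

open Abelian

lemma extVan_retract_right {n : ℕ} {X Y Y' : A} (i : Y' ⟶ Y) (r : Y ⟶ Y') (h : i ≫ r = 𝟙 Y')
    (hv : (extVan.{v, w, x} A).van n X Y) : (extVan.{v, w, x} A).van n X Y' := by
  have : Subsingleton (Ext.{x} X Y (n + 1)) := hv
  refine subsingleton_of_forall_eq (α := Ext.{x} X Y' (n + 1)) 0 fun e => ?_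
  rw [← Ext.comp_mk₀_id e, ← h, ← Ext.mk₀_comp_mk₀, ← Ext.comp_assoc_of_third_deg_zero,
    Subsingleton.elim (e.comp (Ext.mk₀ i) _) 0, Ext.zero_comp]

lemma extVan_retract_left {n : ℕ} {X X' Y : A} (i : X' ⟶ X) (r : X ⟶ X') (h : i ≫ r = 𝟙 X')
    (hv : (extVan.{v, w, x} A).van n X Y) : (extVan.{v, w, x} A).van n X' Y := by
  have : Subsingleton (Ext.{x} X Y (n + 1)) := hv
  refine subsingleton_of_forall_eq (α := Ext.{x} X' Y (n + 1)) 0 fun e => ?_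
  rw [← Ext.mk₀_id_comp e, ← h, ← Ext.mk₀_comp_mk₀, Ext.comp_assoc_of_second_deg_zero,
    Subsingleton.elim ((Ext.mk₀ r).comp e _) 0, Ext.comp_zero]

lemma extVan_projective {n : ℕ} (P Y : A) [Projective P] : (extVan.{v, w, x} A).van n P Y :=
  Ext.subsingleton_of_projective P Y n

lemma extVan_injective {n : ℕ} (X I : A) [Injective I] : (extVan.{v, w, x} A).van n X I :=
  Ext.subsingleton_of_injective X I n

end Retracts

section Modules

variable {R : Type u} [CommRing R]

variable (R) in
/-- The vanishing relation of the `Ext` groups of `R`-modules. -/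
noncomputable abbrev moduleExtVan : ExtVan (ModuleCat.{u} R) := extVan.{u + 1, u, u} _

lemma IsSES.of_linearMap {M N L : Type u} [AddCommGroup M] [Module R M] [AddCommGroup N]
    [Module R N] [AddCommGroup L] [Module R L] {f : M →ₗ[R] N} {g : N →ₗ[R] L}
    (hf : Function.Injective f) (hg : Function.Surjective g) (h : Function.Exact f g) :
    IsSES (ModuleCat.ofHom f) (ModuleCat.ofHom g) :=
  ⟨by ext x; exact h.apply_apply_eq_zero x, ModuleCat.shortComplex_shortExact _ h hf hg⟩

namespace IsSES

variable {M N L : ModuleCat.{u} R} {f : M ⟶ N} {g : N ⟶ L}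

lemma injective (h : IsSES f g) : Function.Injective f.hom :=
  (ModuleCat.mono_iff_injective f).1 h.mono

lemma surjective (h : IsSES f g) : Function.Surjective g.hom :=
  (ModuleCat.epi_iff_surjective g).1 h.epi

lemma exact (h : IsSES f g) : Function.Exact f.hom g.hom :=
  (ShortComplex.ShortExact.moduleCat_exact_iff_function_exact _).1 h.2.exact

end IsSES

/-- `Hom(-, J)` is exact for an injective module `J`. -/
lemma IsSES.hom_injective {M N L : ModuleCat.{u} R} {f : M ⟶ N} {g : N ⟶ L} (h : IsSES f g)
    (J : Type u) [AddCommGroup J] [Module R J] [Module.Injective R J] :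
    IsSES (ModuleCat.ofHom (LinearMap.lcomp R J g.hom))
      (ModuleCat.ofHom (LinearMap.lcomp R J f.hom)) := by
  refine .of_linearMap (fun a b hab => ?_) (fun a => ?_) (fun a => ⟨fun ha => ?_, ?_⟩)
  · ext x
    obtain ⟨y, rfl⟩ := h.surjective x
    exact LinearMap.congr_fun hab y
  · obtain ⟨b, hb⟩ := Module.Injective.out f.hom h.injective a
    exact ⟨b, LinearMap.ext hb⟩
  · obtain ⟨l, hl⟩ := h.exists_desc (ModuleCat.ofHom a) (by ext x; exact LinearMap.congr_fun ha x)
    exact ⟨l.hom, congrArg ModuleCat.Hom.hom hl⟩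
  · rintro ⟨b, rfl⟩
    ext x
    have : g.hom (f.hom x) = 0 := h.exact.apply_apply_eq_zero x
    simp [this]

/-- `Hom(F, J)` is injective if `F` is flat and `J` is injective. -/
lemma injective_hom_of_flat (F J : Type u) [AddCommGroup F] [Module R F] [Module.Flat R F]
    [AddCommGroup J] [Module R J] [Module.Injective R J] : Module.Injective R (F →ₗ[R] J) where
  out X Y _ _ _ _ f hf g := by
    obtain ⟨L, hL⟩ := Module.Injective.out (f.rTensor F)
      (Module.Flat.rTensor_preserves_injective_linearMap f hf) (TensorProduct.lift g)
    exact ⟨TensorProduct.curry L, fun x => by ext y; exact hL (x ⊗ₜ y)⟩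

/-- The syzygies of a resolution by finite free modules. -/
lemma IsSemidualizing.exists_syzygies {C : ModuleCat.{u} R} (hC : IsSemidualizing C) :
    ∃ (Z F : ℕ → ModuleCat.{u} R) (i : ∀ k, Z (k + 1) ⟶ F k) (p : ∀ k, F k ⟶ Z k),
      (∀ k, IsSES (i k) (p k)) ∧ (∀ k, finiteFree R (F k)) ∧ Nonempty (Z 0 ≅ C) := by
  obtain ⟨X⟩ := hC.resolution
  exact ⟨fun k => cokernel (X.cx.d (k + 1) k), X.cx.X, _, _, X.isSES, X.mem, X.nonempty_iso⟩

section Syzygies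

variable {Z F : ℕ → ModuleCat.{u} R} {i : ∀ k, Z (k + 1) ⟶ F k} {p : ∀ k, F k ⟶ Z k}

lemma finite_syzygy (h : ∀ k, IsSES (i k) (p k)) (hF : ∀ k, finiteFree R (F k)) (k : ℕ) :
    Module.Finite R (Z k) :=
  have : Module.Finite R (F k) := (hF k).2
  .of_surjective _ (h k).surjective

lemma finitePresentation_syzygy (h : ∀ k, IsSES (i k) (p k)) (hF : ∀ k, finiteFree R (F k))
    (k : ℕ) : Module.FinitePresentation R (Z k) := by
  have : Module.Free R (F k) := (hF k).1
  have : Module.Finite R (F k) := (hF k).2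
  have := finite_syzygy h hF (k + 1)
  have : Module.Projective R (F k) := .of_free
  have : Module.FinitePresentation R (F k) := Module.finitePresentation_of_projective R _
  refine Module.finitePresentation_of_surjective (p k).hom (h k).surjective ?_
  rw [(h k).exact.linearMap_ker_eq, ← Submodule.map_top]
  exact (Module.Finite.fg_top).map _

lemma projective_of_finiteFree {F : ModuleCat.{u} R} (hF : finiteFree R F) : Projective F := by
  have : Module.Free R F := hF.1
  have : Module.Projective R F := .of_free
  exact F.projective_of_categoryTheory_projective

/-- Dimension shifting along a free resolution in the first variable. -/
lemma van_syzygy (h : ∀ k, IsSES (i k) (p k)) (hF : ∀ k, finiteFree R (F k))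
    {Y : ModuleCat.{u} R} (hY : ∀ n, (moduleExtVan R).van n (Z 0) Y) (k n : ℕ) :
    (moduleExtVan R).van n (Z k) Y := by
  induction k generalizing n with
  | zero => exact hY n
  | succ k ih =>
    have := projective_of_finiteFree (hF k)
    exact (moduleExtVan R).contra_left (h k) (extVan_projective _ _) (ih (n + 1))

/-- `Ext(Z, -)` commutes with direct sums of copies of a module, in the weak form needed here,
because `Hom` from the finitely generated syzygies of `Z` does. -/
lemma van_syzygy_finsupp (h : ∀ k, IsSES (i k) (p k)) (hF : ∀ k, finiteFree R (F k))
    {Y : ModuleCat.{u} R} (hY : ∀ n, (moduleExtVan R).van n (Z 0) Y) (X : Type u) (n k : ℕ) :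
    (moduleExtVan R).van n (Z k) (ModuleCat.of R (X →₀ Y)) := by
  classical
  induction n generalizing k with
  | zero =>
    have := projective_of_finiteFree (hF k)
    refine (moduleExtVan R).contra_zero (h k) (fun f => ?_) (extVan_projective _ _)
    have hlift (x : X) : ∃ l : F k ⟶ Y, i k ≫ l = f ≫ ModuleCat.ofHom (Finsupp.lapply x) :=
      (moduleExtVan R).desc (h k) (van_syzygy h hF hY k 0) _
    choose l hl using hlift
    obtain ⟨s, hs⟩ := (finite_syzygy h hF (k + 1)).fg_top
    let S : Finset X := s.biUnion fun z => (f.hom z).support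
    have hS (z : Z (k + 1)) : (f.hom z).support ⊆ S := by
      have : z ∈ Submodule.span R (s : Set (Z (k + 1))) := hs ▸ Submodule.mem_top
      induction this using Submodule.span_induction with
      | mem z hz => exact Finset.subset_biUnion_of_mem (fun z => (f.hom z).support) hz
      | zero => simp
      | add a b _ _ ha hb =>
        rw [map_add]
        exact Finsupp.support_add.trans (Finset.union_subset ha hb)
      | smul r a _ ha =>
        rw [map_smul]
        exact Finsupp.support_smul.trans ha
    refine ⟨ModuleCat.ofHom (∑ x ∈ S, Finsupp.lsingle x ∘ₗ (l x).hom), ?_⟩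
    ext z : 2
    have hl' (x : X) : (l x).hom ((i k).hom z) = f.hom z x :=
      LinearMap.congr_fun (congrArg ModuleCat.Hom.hom (hl x)) z
    change (∑ x ∈ S, Finsupp.lsingle x ∘ₗ (l x).hom) ((i k).hom z) = f.hom z
    rw [LinearMap.sum_apply]
    simp only [LinearMap.comp_apply, hl', Finsupp.lsingle_apply]
    exact ((f.hom z).sum_of_support_subset (hS z) Finsupp.single (by simp)).symm.trans
      (f.hom z).sum_single
  | succ n ih =>
    have := projective_of_finiteFree (hF k)
    exact (moduleExtVan R).contra_right (h k) (ih (k + 1)) (extVan_projective _ _)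

end Syzygies

/-- `Ext(-, Y)` turns direct sums of copies of a module into products, in the weak form needed
here. -/
lemma van_finsupp_left {C : ModuleCat.{u} R} (X : Type u) {n : ℕ} {Y : ModuleCat.{u} R}
    (h : (moduleExtVan R).van n C Y) : (moduleExtVan R).van n (ModuleCat.of R (X →₀ C)) Y := by
  obtain ⟨I, Q, ι, π, hI, hs⟩ : ∃ (I Q : ModuleCat.{u} R) (ι : Y ⟶ I) (π : I ⟶ Q),
      Injective I ∧ IsSES ι π := ⟨_, _, _, _, inferInstance, IsSES.of_mono (Injective.ι Y)⟩
  induction n generalizing Y I Q with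
  | zero =>
    refine (moduleExtVan R).cov_zero hs (fun f => ?_) (extVan_injective _ _)
    have hlift (x : X) := (moduleExtVan R).lift hs h (ModuleCat.ofHom (Finsupp.lsingle x) ≫ f)
    choose l hl using hlift
    refine ⟨ModuleCat.ofHom (Finsupp.lsum R fun x => (l x).hom), ?_⟩
    ext : 1
    refine Finsupp.lhom_ext' fun x => ?_
    ext c
    have := LinearMap.congr_fun (congrArg ModuleCat.Hom.hom (hl x)) c
    simpa using this
  | succ n ih =>
    obtain ⟨I', Q', ι', π', hI', hs'⟩ : ∃ (I' Q' : ModuleCat.{u} R) (ι' : Q ⟶ I') (π' : I' ⟶ Q'),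
      Injective I' ∧ IsSES ι' π' := ⟨_, _, _, _, inferInstance, IsSES.of_mono (Injective.ι Q)⟩
    have hQ := (moduleExtVan R).cov_right hs (extVan_injective _ _) h
    exact (moduleExtVan R).cov_left hs (ih hQ I' Q' ι' π' hI' hs') (extVan_injective _ _)

open TensorProduct in
/-- A module in `cProjective C` is a direct summand of a direct sum of copies of `C`. -/
lemma cProjective.exists_retract {C M : ModuleCat.{u} R} (hM : cProjective C M) :
    ∃ (X : Type u) (i : M ⟶ ModuleCat.of R (X →₀ C)) (r : ModuleCat.of R (X →₀ C) ⟶ M),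
      i ≫ r = 𝟙 M := by
  classical
  obtain ⟨P, hP, ⟨e⟩⟩ := hM
  obtain ⟨s, hs⟩ := Module.projective_def'.1 hP
  let e' : (P →₀ R) ⊗[R] C ≃ₗ[R] (P →₀ C) := TensorProduct.finsuppScalarLeft R C P
  refine ⟨P, ModuleCat.ofHom (e'.toLinearMap ∘ₗ s.rTensor C ∘ₗ e.toLinearMap),
    ModuleCat.ofHom (e.symm.toLinearMap ∘ₗ
      (Finsupp.linearCombination R id).rTensor C ∘ₗ e'.symm.toLinearMap), ?_⟩
  ext m
  simp only [ModuleCat.hom_comp, ModuleCat.hom_ofHom, LinearMap.comp_apply, LinearEquiv.coe_coe,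
    LinearEquiv.symm_apply_apply]
  rw [← LinearMap.comp_apply (LinearMap.rTensor C _), ← LinearMap.rTensor_comp, hs]
  simp

lemma IsSemidualizing.perp_cProjective {C : ModuleCat.{u} R} (hC : IsSemidualizing C) :
    Perp.{u + 1, u, u} (cProjective C) (cProjective C) := by
  intro M N hM hN n hn
  obtain ⟨n, rfl⟩ : ∃ m, n = m + 1 := ⟨n - 1, by omega⟩
  obtain ⟨Z, F, i, p, h, hF, ⟨e⟩⟩ := hC.exists_syzygies
  obtain ⟨X, a, r, har⟩ := hM.exists_retract
  obtain ⟨Y, b, s, hbs⟩ := hN.exists_retract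
  have h0 (n : ℕ) : (moduleExtVan R).van n (Z 0) C :=
    extVan_retract_left e.hom e.inv e.hom_inv_id (hC.ext (n + 1) (Nat.le_add_left 1 n))
  exact extVan_retract_left a r har (extVan_retract_right b s hbs (van_finsupp_left X
    (extVan_retract_left e.inv e.hom e.inv_hom_id (van_syzygy_finsupp h hF h0 Y n 0))))

open TensorProduct in
/-- Along `0 ⟶ Zₖ₊₁ ⟶ Fₖ ⟶ Zₖ ⟶ 0`, dimension shifting reduces the claim to lifting maps
`Hom(C, I) ⟶ Hom(Zₖ₊₁, J)` to `Hom(Fₖ, J)`. By adjunction and injectivity of `J` this is the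
injectivity of `Hom(C, I) ⊗ Zₖ₊₁ ⟶ Hom(C, I) ⊗ Fₖ`, which `tensorEval` translates into the
surjectivity of `Hom(Fₖ, C) ⟶ Hom(Zₖ₊₁, C)`, that is, into `Ext¹(Zₖ, C) = 0`. -/
lemma IsSemidualizing.perp_cInjective {C : ModuleCat.{u} R} (hC : IsSemidualizing C) :
    Perp.{u + 1, u, u} (cInjective C) (cInjective C) := by
  rintro M N ⟨I, hI, ⟨eM⟩⟩ ⟨J, hJ, ⟨eN⟩⟩ n hn
  obtain ⟨n, rfl⟩ : ∃ m, n = m + 1 := ⟨n - 1, by omega⟩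
  obtain ⟨Z, F, i, p, h, hF, ⟨e⟩⟩ := hC.exists_syzygies
  have h0 (n : ℕ) : (moduleExtVan R).van n (Z 0) C :=
    extVan_retract_left e.hom e.inv e.hom_inv_id (hC.ext (n + 1) (Nat.le_add_left 1 n))
  have hinj (k : ℕ) : Injective (ModuleCat.of R (F k →ₗ[R] J)) := by
    have : Module.Free R (F k) := (hF k).1
    have := injective_hom_of_flat (R := R) (F k) J
    exact Module.injective_object_of_injective_module R _
  have hten (k : ℕ) : Function.Injective ((i k).hom.lTensor (C →ₗ[R] I)) := by
    have := finitePresentation_syzygy h hF (k + 1)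
    refine (injective_iff_map_eq_zero _).2 fun t ht => ?_
    refine (tensorEval_bijective (R := R) (B := C) (D := Z (k + 1)) (I := I)).1 ?_
    ext g
    obtain ⟨l, hl⟩ := (moduleExtVan R).desc (h k) (van_syzygy h hF h0 k 0) (ModuleCat.ofHom g)
    have hl' : l.hom ∘ₗ (i k).hom = g := congrArg ModuleCat.Hom.hom hl
    rw [← hl', ← tensorEval_lTensor, ht]
    simp
  have key (n : ℕ) : ∀ k, (moduleExtVan R).van n (ModuleCat.of R (C →ₗ[R] I))
      (ModuleCat.of R (Z k →ₗ[R] J)) := by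
    induction n with
    | zero =>
      intro k
      have := hinj k
      refine (moduleExtVan R).cov_zero ((h k).hom_injective J) (fun f => ?_) (extVan_injective _ _)
      obtain ⟨L, hL⟩ := Module.Injective.out _ (hten k) (TensorProduct.lift f.hom)
      exact ⟨ModuleCat.ofHom (TensorProduct.curry L), by ext x z; exact hL (x ⊗ₜ z)⟩
    | succ n ih =>
      intro k
      have := hinj k
      exact (moduleExtVan R).cov_left ((h k).hom_injective J) (ih (k + 1)) (extVan_injective _ _)
  let eC := e.toLinearEquiv
  refine extVan_retract_left (ModuleCat.ofHom eM.toLinearMap) (ModuleCat.ofHom eM.symm.toLinearMap)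
    (by ext x; simp) (extVan_retract_right
      (ModuleCat.ofHom ((LinearMap.lcomp R J eC.toLinearMap) ∘ₗ eN.toLinearMap))
      (ModuleCat.ofHom (eN.symm.toLinearMap ∘ₗ (LinearMap.lcomp R J eC.symm.toLinearMap))) ?_
      (key n 0))
  ext x
  apply eN.injective
  ext c
  simp

/-! ### Closure properties of the classes attached to a semidualizing module -/

namespace IsSemidualizing

variable {C : ModuleCat.{u} R}

lemma finitePresentation (hC : IsSemidualizing C) : Module.FinitePresentation R C := by
  obtain ⟨Z, F, i, p, h, hF, ⟨e⟩⟩ := hC.exists_syzygies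
  have := finitePresentation_syzygy h hF 0
  exact Module.FinitePresentation.of_equiv e.toLinearEquiv

lemma faithful (hC : IsSemidualizing C) (r : R) (hr : ∀ c : C, r • c = 0) : r = 0 :=
  hC.homothety.1 (by ext c; rw [map_zero]; exact hr c)

lemma cProjective_iff (hC : IsSemidualizing C) {M : ModuleCat.{u} R} :
    cProjective C M ↔ IsCProj R C M := by
  have := hC.finitePresentation
  constructor
  · rintro ⟨P, hP, ⟨e⟩⟩
    exact (isCProj_tensor hC.homothety P).of_retract e.toLinearMap e.symm.toLinearMap (by simp)
  · exact fun h => ⟨ModuleCat.of R (C →ₗ[R] M), h.1, ⟨(LinearEquiv.ofBijective _ h.2).symm⟩⟩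

lemma cInjective_iff (hC : IsSemidualizing C) {M : ModuleCat.{u} R} :
    cInjective C M ↔ IsCInj R C M := by
  have := hC.finitePresentation
  constructor
  · rintro ⟨I, hI, ⟨e⟩⟩
    exact (isCInj_hom hC.homothety I).of_retract e.toLinearMap e.symm.toLinearMap (by simp)
  · exact fun h => ⟨ModuleCat.of R (TensorProduct R M C), h.1, ⟨LinearEquiv.ofBijective _ h.2⟩⟩

lemma cProjective_kernels (hC : IsSemidualizing C) : ClosedUnderKernelsOfEpis (cProjective C) := by
  intro S hS h₂ h₃
  have := hC.finitePresentation
  have h : IsSES S.f S.g := ⟨S.zero, hS⟩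
  obtain ⟨s, hs⟩ := (hC.cProjective_iff.1 h₂).exists_section hC.faithful (hC.cProjective_iff.1 h₃)
    S.g.hom h.surjective
  have hs' : ModuleCat.ofHom s ≫ S.g = 𝟙 _ := by ext x; exact LinearMap.congr_fun hs x
  have := h.mono
  obtain ⟨r, hr⟩ := h.exists_lift (𝟙 _ - S.g ≫ ModuleCat.ofHom s) (by simp [hs'])
  have hr' : S.f ≫ r = 𝟙 _ := by
    rw [← cancel_mono S.f, Category.assoc, hr]
    simp
  exact hC.cProjective_iff.2 ((hC.cProjective_iff.1 h₂).of_retract S.f.hom r.hom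
    fun x => LinearMap.congr_fun (congrArg ModuleCat.Hom.hom hr') x)

lemma cInjective_cokernels (hC : IsSemidualizing C) :
    ClosedUnderCokernelsOfMonos (cInjective C) := by
  intro S hS h₁ h₂
  have := hC.finitePresentation
  have h : IsSES S.f S.g := ⟨S.zero, hS⟩
  obtain ⟨s, hs⟩ := (hC.cInjective_iff.1 h₁).exists_retraction hC.faithful
    (hC.cInjective_iff.1 h₂) S.f.hom h.injective
  have hs' : S.f ≫ ModuleCat.ofHom s = 𝟙 _ := by ext x; exact LinearMap.congr_fun hs x
  have := h.epi
  obtain ⟨r, hr⟩ := h.exists_desc (𝟙 _ - ModuleCat.ofHom s ≫ S.f) (by simp [reassoc_of% hs'])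
  have hr' : r ≫ S.g = 𝟙 _ := by
    rw [← cancel_epi S.g, ← Category.assoc, hr]
    simp
  exact hC.cInjective_iff.2 ((hC.cInjective_iff.1 h₂).of_retract r.hom S.g.hom
    fun x => LinearMap.congr_fun (congrArg ModuleCat.Hom.hom hr') x)

end IsSemidualizing

lemma isSubcategory_cProjective (C : ModuleCat.{u} R) : IsSubcategory (cProjective C) where
  zero X hX := by
    have := ModuleCat.subsingleton_of_isZero hX
    have : Subsingleton (TensorProduct R PUnit.{u + 1} C) :=
      subsingleton_of_forall_eq 0 fun t => by
        induction t with
        | zero => rfl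
        | tmul a c => rw [Subsingleton.elim a 0, TensorProduct.zero_tmul]
        | add a b ha hb => rw [ha, hb, add_zero]
    exact ⟨ModuleCat.of R PUnit, inferInstance, ⟨0, 0, fun _ => Subsingleton.elim _ _,
      fun _ => Subsingleton.elim _ _⟩⟩
  iso e := fun ⟨P, hP, ⟨e'⟩⟩ => ⟨P, hP, ⟨e.toLinearEquiv.symm.trans e'⟩⟩
  biprod X Y := fun ⟨P, hP, ⟨e⟩⟩ ⟨Q, hQ, ⟨e'⟩⟩ =>
    ⟨ModuleCat.of R (P × Q), inferInstance, ⟨(ModuleCat.biprodIsoProd X Y).toLinearEquiv.trans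
      ((e.prodCongr e').trans (TensorProduct.prodLeft R R P Q C).symm)⟩⟩

lemma isSubcategory_cInjective (C : ModuleCat.{u} R) : IsSubcategory (cInjective C) where
  zero X hX := by
    have := ModuleCat.subsingleton_of_isZero hX
    exact ⟨ModuleCat.of R PUnit, ⟨fun _ _ _ _ _ _ _ _ _ => ⟨0, fun _ => Subsingleton.elim _ _⟩⟩,
      ⟨0, 0, fun _ => Subsingleton.elim _ _, fun _ => Subsingleton.elim _ _⟩⟩
  iso e := fun ⟨P, hP, ⟨e'⟩⟩ => ⟨P, hP, ⟨e.toLinearEquiv.symm.trans e'⟩⟩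
  biprod X Y := fun ⟨I, hI, ⟨e⟩⟩ ⟨J, hJ, ⟨e'⟩⟩ =>
    ⟨ModuleCat.of R (I × J), ⟨fun _ _ _ _ _ _ f hf g => by
        obtain ⟨a, ha⟩ := Module.Injective.out f hf (LinearMap.fst R I J ∘ₗ g)
        obtain ⟨b, hb⟩ := Module.Injective.out f hf (LinearMap.snd R I J ∘ₗ g)
        exact ⟨a.prod b, fun x => Prod.ext (ha x) (hb x)⟩⟩,
      ⟨(ModuleCat.biprodIsoProd X Y).toLinearEquiv.trans
        ((e.prodCongr e').trans (LinearMap.prodEquiv R))⟩⟩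

end Modules

end Tate

theorem theorem3p7 :
    -- modules over a commutative ring with a semidualizing module
    (∀ (R : Type u) [CommRing R] (C : ModuleCat.{u} R), Tate.IsSemidualizing C →
      (∀ M : ModuleCat.{u} R, Tate.AdmitsTateResolution (Tate.cProjective C) M ↔
        Tate.projDim (Tate.Gor (Tate.cProjective C)) M < ⊤) ∧
      (∀ N : ModuleCat.{u} R, Tate.AdmitsTateCoresolution (Tate.cInjective C) N ↔
        Tate.injDim (Tate.Gor (Tate.cInjective C)) N < ⊤) ∧
      Tate.ClosedUnderSummands (Tate.FiniteProjDim (Tate.Gor (Tate.cProjective C))) ∧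
      Tate.TwoOfThree (Tate.FiniteProjDim (Tate.Gor (Tate.cProjective C))) ∧
      Tate.ClosedUnderSummands (Tate.FiniteInjDim (Tate.Gor (Tate.cInjective C))) ∧
      Tate.TwoOfThree (Tate.FiniteInjDim (Tate.Gor (Tate.cInjective C)))) ∧
    -- an arbitrary abelian category
    (∀ (A : Type v) [Category.{w} A] [Abelian A] [HasExt.{x} A] (W : ObjectProperty A),
      Tate.IsSubcategory W → Tate.ClosedUnderKernelsOfEpis W → Tate.Perp.{v, w, x} W W →
      (∀ M : A, Tate.AdmitsTateResolution W M ↔ Tate.projDim (Tate.Gor W) M < ⊤) ∧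
      (∀ M : A, (∃ t : Tate.TateResolution W M, ∀ n : ℕ, IsSplitEpi (t.α n)) ↔
        Tate.projDim (Tate.Gor W) M < ⊤) ∧
      Tate.ClosedUnderSummands (Tate.AdmitsTateResolution W) ∧
      Tate.TwoOfThree (Tate.AdmitsTateResolution W)) ∧
    (∀ (A : Type v) [Category.{w} A] [Abelian A] [HasExt.{x} A] (V : ObjectProperty A),
      Tate.IsSubcategory V → Tate.ClosedUnderCokernelsOfMonos V → Tate.Perp.{v, w, x} V V →
      (∀ N : A, Tate.AdmitsTateCoresolution V N ↔ Tate.injDim (Tate.Gor V) N < ⊤) ∧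
      (∀ N : A, (∃ t : Tate.TateCoresolution V N, ∀ n : ℕ, IsSplitMono (t.β n)) ↔
        Tate.injDim (Tate.Gor V) N < ⊤) ∧
      Tate.ClosedUnderSummands (Tate.AdmitsTateCoresolution V) ∧
      Tate.TwoOfThree (Tate.AdmitsTateCoresolution V)) := by
  refine ⟨fun R _ C hC => ?_, fun A _ _ _ => Tate.tateResolution_abelian,
    fun A _ _ _ => Tate.tateCoresolution_abelian⟩
  obtain ⟨h₁, -, h₂, h₃⟩ := Tate.tateResolution_abelian _ (Tate.isSubcategory_cProjective C)
    hC.cProjective_kernels hC.perp_cProjective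
  obtain ⟨h₁', -, h₂', h₃'⟩ := Tate.tateCoresolution_abelian _ (Tate.isSubcategory_cInjective C)
    hC.cInjective_cokernels hC.perp_cInjective
  have e : Tate.AdmitsTateResolution (Tate.cProjective C) =
      Tate.FiniteProjDim (Tate.Gor (Tate.cProjective C)) := by ext M; exact h₁ M
  have e' : Tate.AdmitsTateCoresolution (Tate.cInjective C) =
      Tate.FiniteInjDim (Tate.Gor (Tate.cInjective C)) := by ext M; exact h₁' M
  exact ⟨h₁, h₁', e ▸ h₂, e ▸ h₃, e' ▸ h₂', e' ▸ h₃'⟩
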